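/- Let $N\in\mathbb N$, $p\in(1,\infty)$, and let $d\gamma_N(x)=(2\pi)^{-N/2}e^{-|x|^2/2}\,dx$ be the Gauss measure on $\mathbb R^N$. Write $m(f)=\int f\,d\gamma_N$, $f^*(t)=\inf\{s\ge 0:\gamma_N\{|f|>s\}\le t\}$ for the non-increasing rearrangement of $f$ with respect to $\gamma_N$, and $$\|f\|_{L^p(\log L)^p(\gamma_N)}=\Big(\int_0^1[(1-\log t)f^*(t)]^p\,dt\Big)^{1/p}\in[0,\infty].$$ Let $\mathcal L=\Delta-x\cdot\nabla$ be the Ornstein–Uhlenbeck operator and, for $t>0$, $$G_tf(x)=(1-e^{-2t})^{-N/2}\int_{\mathbb R^N}\exp\Big(-\frac{e^{-2t}(|x|^2+|y|^2)-2e^{-t}x\cdot y}{2(1-e^{-2t})}\Big)f(y)\,d\gamma_N(y)$$ the Ornstein–Uhlenbeck semigroup, which is generated by $\mathcal L$. Let $\{\rho_\varepsilon\}_{\varepsilon>0}$ be non-negative functions that vanish outside $(0,1)$, with $\int_0^\infty\rho_\varepsilon(t)\,dt=1$ for every $\varepsilon>0$ and $\lim_{\varepsilon\to0^+}\int_0^a\rho_\varepsilon(t)\,dt=1$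 for every $a\in(0,1)$. For $t\in(0,1)$ put $$\Upsilon_\varepsilon(t)=(1-\log t)^p\int_0^{(1-\log t)^{-1}}\rho_\varepsilon(u)\,du+\int_{(1-\log t)^{-1}}^1\frac{\rho_\varepsilon(u)}{u^p}\,du .$$ Then the following hold. (i) For every real-valued $f\in L^p(\gamma_N)$, as a limit in $[0,\infty]$, $$\lim_{\varepsilon\to0^+}\int_0^1\big([f-m(f)]^*(t)\big)^p\,\Upsilon_\varepsilon(t)\,dt=\|f-m(f)\|^p_{L^p(\log L)^p(\gamma_N)} .$$ (ii) For every real-valued $f\in L^p(\gamma_N)$ whose distributional image $\mathcal Lf=\Delta f-x\cdot\nabla f$ belongs to $L^p(\gamma_N)$, $$\lim_{\varepsilon\to0^+}\int_{\mathbb R^N}\int_0^1\frac{|f(x)-G_tf(x)|^p}{t^p}\,\rho_\varepsilon(t)\,dt\,d\gamma_N(x)=\|\mathcal Lf\|^p_{L^p(\gamma_N)} .$$ (iii) Consequently the Gaussian Sobolev inequality is recovered in the limit: if $f$ is as in (ii), $C\in[0,\infty)$, and $$\int_0^1\big([f-m(f)]^*(t)\big)^p\,\Upsilon_\varepsilon(t)\,dt\le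 C\int_{\mathbb R^N}\int_0^1\frac{|f(x)-G_tf(x)|^p}{t^p}\,\rho_\varepsilon(t)\,dt\,d\gamma_N(x)\qquad\text{for all }\varepsilon>0,$$ then $\|f-m(f)\|_{L^p(\log L)^p(\gamma_N)}\le C^{1/p}\,\|\mathcal Lf\|_{L^p(\gamma_N)}$. -/

import Mathlib

open MeasureTheory Filter Topology Set
open scoped ENNReal NNReal ContDiff

noncomputable section

namespace GaussSobolev

/-- `ℝ^N` with its Euclidean norm. -/
abbrev Space (N : ℕ) : Type := EuclideanSpace ℝ (Fin N)

/-- The Gauss measure `dγ_N(x) = (2π)^{-N/2} exp(-|x|²/2) dx` on `ℝ^N`. -/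
def gaussMeasure (N : ℕ) : Measure (Space N) :=
  (volume : Measure (Space N)).withDensity fun x =>
    ENNReal.ofReal ((2 * Real.pi) ^ (-(N : ℝ) / 2) * Real.exp (-‖x‖ ^ 2 / 2))

/-- The mean `m(f) = ∫ f dγ_N`. -/
def mean {N : ℕ} (f : Space N → ℝ) : ℝ := ∫ x, f x ∂gaussMeasure N

/-- The Ornstein-Uhlenbeck differential operator `φ ↦ Δφ - x · ∇φ`, used on smooth functions. -/
def ouOperator {N : ℕ} (φ : Space N → ℝ) (x : Space N) : ℝ :=
  Laplacian.laplacian φ x - inner ℝ x (gradient φ x)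

/-- `f ∈ L^p(γ_N)` and `h ∈ L^p(γ_N)` satisfy `Δf - x · ∇f = h` in the sense of distributions.
Since `∫ u (Δφ - x · ∇φ) dγ_N = ∫ (Δu - x · ∇u) φ dγ_N` for smooth `u` and for test functions `φ`,
the distributional equation, tested with `φ` times the Gaussian density, is the one below.
Thus `f` belongs to the Sobolev space of the operator if and only if such an `h` exists, and then
`h` is unique up to `γ_N`-null sets. -/
structure HasOU {N : ℕ} (p : ℝ) (f h : Space N → ℝ) : Prop where
  memLp : MemLp f (ENNReal.ofReal p) (gaussMeasure N)
  memLp_image : MemLp h (ENNReal.ofReal p) (gaussMeasure N)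
  integral_eq : ∀ φ : Space N → ℝ, ContDiff ℝ ∞ φ → HasCompactSupport φ →
    ∫ x, f x * ouOperator φ x ∂gaussMeasure N = ∫ x, h x * φ x ∂gaussMeasure N

/-- The Ornstein-Uhlenbeck semigroup, generated by `Δ - x · ∇`, through the Mehler kernel:
`G_t f(x) = (1-e^{-2t})^{-N/2}
  ∫ exp(-(e^{-2t}(|x|²+|y|²) - 2e^{-t} x·y) / (2(1-e^{-2t}))) f(y) dγ_N(y)` for `t > 0`. -/
def ouSemigroup {N : ℕ} (t : ℝ) (f : Space N → ℝ) (x : Space N) : ℝ :=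
  (1 - Real.exp (-2 * t)) ^ (-(N : ℝ) / 2) *
    ∫ y, Real.exp (-(Real.exp (-2 * t) * (‖x‖ ^ 2 + ‖y‖ ^ 2) - 2 * Real.exp (-t) * inner ℝ x y)
      / (2 * (1 - Real.exp (-2 * t)))) * f y ∂gaussMeasure N

/-- The non-increasing rearrangement `f^*(t) = inf {s ≥ 0 : γ_N {|f| > s} ≤ t}`. -/
def rearrangement {N : ℕ} (f : Space N → ℝ) (t : ℝ) : ℝ≥0∞ :=
  sInf {s : ℝ≥0∞ | gaussMeasure N {x | s < ‖f x‖ₑ} ≤ ENNReal.ofReal t}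

/-- The Zygmund functional `(∫₀¹ [(1 - log t) f^*(t)]^p dt)^{1/p}` of `L^p (log L)^p(γ_N)`,
with values in `[0, ∞]`. -/
def zygmundNorm {N : ℕ} (p : ℝ) (f : Space N → ℝ) : ℝ≥0∞ :=
  (∫⁻ t in Ioo (0 : ℝ) 1, (ENNReal.ofReal (1 - Real.log t) * rearrangement f t) ^ p) ^ (1 / p)

/-- `Υ(t) = (1 - log t)^p ∫_0^{1/(1 - log t)} ρ(u) du + ∫_{1/(1 - log t)}^1 ρ(u) u^{-p} du`. -/
def upsilon (p : ℝ) (ρ : ℝ → ℝ) (t : ℝ) : ℝ≥0∞ :=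
  ENNReal.ofReal ((1 - Real.log t) ^ p) *
      (∫⁻ u in Ioo 0 (1 - Real.log t)⁻¹, ENNReal.ofReal (ρ u)) +
    ∫⁻ u in Ioo (1 - Real.log t)⁻¹ 1, ENNReal.ofReal (ρ u / u ^ p)

/-- `∫₀¹ ([f - m(f)]^*(t))^p Υ(t) dt`. -/
def rearrangementIntegral {N : ℕ} (p : ℝ) (ρ : ℝ → ℝ) (f : Space N → ℝ) : ℝ≥0∞ :=
  ∫⁻ t in Ioo (0 : ℝ) 1, rearrangement (fun x => f x - mean f) t ^ p * upsilon p ρ t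

/-- The Gaussian Besov-type integral `∫_{ℝ^N} ∫₀¹ |f(x) - G_t f(x)|^p t^{-p} ρ(t) dt dγ_N(x)`. -/
def besovIntegral {N : ℕ} (p : ℝ) (ρ : ℝ → ℝ) (f : Space N → ℝ) : ℝ≥0∞ :=
  ∫⁻ x, (∫⁻ t in Ioo (0 : ℝ) 1, ENNReal.ofReal (|f x - ouSemigroup t f x| ^ p / t ^ p * ρ t))
    ∂gaussMeasure N

end GaussSobolev

end

/-!
The three limits rest on two soft facts about the kernels `ρ ε`, probability densities on `(0, 1)`
that concentrate at the origin, and on one fact about the Ornstein-Uhlenbeck semigroup.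

*Rearrangements.* Since `u ^ (-p) ≤ (1 - log t) ^ p` for `u ≥ 1 / (1 - log t)`, the weight `Υ_ε(t)`
is at most `(1 - log t) ^ p` (`upsilon_le`), while on `t > δ` it is at least `(1 - log t) ^ p` times
the `ρ ε`-mass of a fixed interval `(0, a)`, which tends to `1` (`le_upsilon`). Exhausting `(0, 1)`
by the intervals `(δ, 1)` gives the first limit, also when it is infinite
(`tendsto_lintegral_upsilon`).

*Besov integrals.* By Tonelli the Besov integral is the `ρ ε`-average of
`Φ(t) = ‖(G_t f - f) / t‖ ^ p`, and averages of a bounded function converge to its right limit at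
the origin (`IsConcentrating.tendsto_lintegral`). So it suffices that `Φ` is bounded and tends to
`‖𝓛 f‖ ^ p`. This follows from Duhamel's formula `G_t f - f = ∫₀ᵗ G_s h ds`, `h = 𝓛 f`
(`HasOU.ouSemigroup_sub_ae_eq`), together with the contractivity and the strong continuity of the
semigroup on `L^p` (`tendsto_eLpNorm_ouAverage`).

*Duhamel's formula.* By Mehler's formula, `G_s f(x)` is the mean of `f(e^{-s} x + √(1 - e^{-2s}) z)`
over a standard Gaussian vector `z`. The map
`(x, z) ↦ (e^{-s} x + √(1 - e^{-2s}) z, √(1 - e^{-2s}) x - e^{-s} z)` is an involution that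
preserves `γ_N ⊗ γ_N`; this gives the symmetry and the contractivity of `G_s`. On plane waves
`cos (ξ · x + c)` the semigroup is explicit and solves the Ornstein-Uhlenbeck equation
(`hasDerivAt_waveEvolution`). The distributional equation `𝓛 f = h`, a priori tested with compactly
supported functions, extends to plane waves by a cut-off (`HasOU.integral_eq_of_bounded`), because
functions of linear growth are `γ_N`-integrable against `f ∈ L^p`, `p > 1`. Hence both sides of
Duhamel's formula have the same integral against every plane wave, and plane waves separate
integrable functions (`ae_eq_zero_of_integral_mul_wave`).

The averages `(1 / t) ∫₀ᵗ G_s h ds` are written as one mean, over a uniform time and a Gaussian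
vector (`ouAverage`), so that a single application of Jensen's inequality reduces their convergence
to `h` to that of `h` along the Mehler flow, where `h` may be replaced by a bounded continuous
function.
-/

noncomputable section

namespace GaussSobolev

/-! ### Averaging against kernels that concentrate at the origin -/

/-- The hypotheses on the family `ρ ε`, in terms of lower integrals: the `ρ ε` are measurable
probability densities on `(0, 1)` whose mass concentrates at the origin as `ε → 0+`. -/
structure IsConcentrating (ρ : ℝ → ℝ → ℝ) : Prop where
  aemeasurable : ∀ ε > 0, AEMeasurable (ρ ε) (volume.restrict (Ioo 0 1))
  mass_eq_one : ∀ ε > 0, ∫⁻ u in Ioo 0 1, ENNReal.ofReal (ρ ε u) = 1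
  tendsto_mass : ∀ a ∈ Ioo (0 : ℝ) 1,
    Tendsto (fun ε => ∫⁻ u in Ioo 0 a, ENNReal.ofReal (ρ ε u)) (𝓝[>] 0) (𝓝 1)

lemma isConcentrating_of_integral {ρ : ℝ → ℝ → ℝ}
    (hρ_nonneg : ∀ ε > 0, ∀ t, 0 ≤ ρ ε t)
    (hρ_supp : ∀ ε > 0, Function.support (ρ ε) ⊆ Ioo 0 1)
    (hρ_norm : ∀ ε > 0, ∫ t in Ioi 0, ρ ε t = 1)
    (hρ_conc : ∀ a ∈ Ioo (0 : ℝ) 1,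
      Tendsto (fun ε => ∫ t in Ioo 0 a, ρ ε t) (𝓝[>] 0) (𝓝 1)) :
    IsConcentrating ρ := by
  -- A non-integrable `ρ ε` would have Bochner integral `0`, not `1`.
  have hint : ∀ ε > 0, IntegrableOn (ρ ε) (Ioi 0) := fun ε hε => by
    by_contra h
    have := hρ_norm ε hε
    rw [integral_undef h] at this
    exact zero_ne_one this
  have hsub : ∀ a : ℝ, Ioo 0 a ⊆ Ioi 0 := fun a x hx => hx.1
  have hof : ∀ ε > 0, ∀ a : ℝ,
      ∫⁻ u in Ioo 0 a, ENNReal.ofReal (ρ ε u) = ENNReal.ofReal (∫ u in Ioo 0 a, ρ ε u) :=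
    fun ε hε a => (ofReal_integral_eq_lintegral_ofReal ((hint ε hε).mono_set (hsub a))
      (ae_of_all _ (hρ_nonneg ε hε))).symm
  refine ⟨fun ε hε => ((hint ε hε).mono_set (hsub 1)).aemeasurable, fun ε hε => ?_, fun a ha => ?_⟩
  · rw [hof ε hε, setIntegral_eq_of_subset_of_forall_sdiff_eq_zero measurableSet_Ioi (hsub 1)
      (fun x hx => ?_) |>.symm, hρ_norm ε hε, ENNReal.ofReal_one]
    by_contra h
    exact hx.2 (hρ_supp ε hε h)
  · have := (ENNReal.tendsto_ofReal (hρ_conc a ha))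
    rw [ENNReal.ofReal_one] at this
    refine this.congr' ?_
    filter_upwards [self_mem_nhdsWithin] with ε hε using (hof ε hε a).symm

namespace IsConcentrating

variable {ρ : ℝ → ℝ → ℝ}

lemma mass_add_mass (hρ : IsConcentrating ρ) {ε : ℝ} (hε : 0 < ε) {a : ℝ}
    (ha : a ∈ Ioo (0 : ℝ) 1) :
    (∫⁻ u in Ioo 0 a, ENNReal.ofReal (ρ ε u)) + ∫⁻ u in Ico a 1, ENNReal.ofReal (ρ ε u) = 1 := by
  rw [← hρ.mass_eq_one ε hε, ← lintegral_union measurableSet_Ico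
    (disjoint_left.2 fun x hx hx' => absurd hx.2 (not_lt.2 hx'.1)),
    Ioo_union_Ico_eq_Ioo ha.1 ha.2.le]

lemma tendsto_tail (hρ : IsConcentrating ρ) {a : ℝ} (ha : a ∈ Ioo (0 : ℝ) 1) :
    Tendsto (fun ε => ∫⁻ u in Ico a 1, ENNReal.ofReal (ρ ε u)) (𝓝[>] 0) (𝓝 0) := by
  have h := ENNReal.Tendsto.sub (tendsto_const_nhds (x := (1 : ℝ≥0∞))) (hρ.tendsto_mass a ha)
    (Or.inl ENNReal.one_ne_top)
  rw [tsub_self] at h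
  refine h.congr' ?_
  filter_upwards [self_mem_nhdsWithin] with ε hε
  have h1 := hρ.mass_add_mass hε ha
  refine ENNReal.sub_eq_of_eq_add ?_ (h1.symm.trans (add_comm _ _))
  exact ne_top_of_le_ne_top ENNReal.one_ne_top (h1 ▸ le_self_add)

/-- The averages of a bounded function against the `ρ ε` converge to its right limit at `0`. -/
lemma tendsto_lintegral (hρ : IsConcentrating ρ) {Φ : ℝ → ℝ≥0∞} {A M : ℝ≥0∞}
    (hΦ : Tendsto Φ (𝓝[>] 0) (𝓝 A)) (hM : M ≠ ⊤) (hΦM : ∀ t ∈ Ioo (0 : ℝ) 1, Φ t ≤ M) :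
    Tendsto (fun ε => ∫⁻ t in Ioo 0 1, ENNReal.ofReal (ρ ε t) * Φ t) (𝓝[>] 0) (𝓝 A) := by
  have hnear : ∀ {P : ℝ → Prop}, (∀ᶠ t in 𝓝[>] (0 : ℝ), P t) →
      ∃ a ∈ Ioo (0 : ℝ) 1, ∀ t ∈ Ioo 0 a, P t := fun {P} hP => by
    obtain ⟨b, hb, hP⟩ := (mem_nhdsGT_iff_exists_Ioo_subset).1 hP
    exact ⟨min b (1 / 2), ⟨lt_min hb (by norm_num), (min_le_right _ _).trans_lt (by norm_num)⟩,
      fun t ht => hP ⟨ht.1, ht.2.trans_le (min_le_left _ _)⟩⟩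
  refine tendsto_order.2 ⟨fun b hb => ?_, fun b hb => ?_⟩
  · obtain ⟨c, hbc, hcA⟩ := exists_between hb
    obtain ⟨a, ha, hac⟩ := hnear (hΦ.eventually_const_lt hcA)
    have h := ENNReal.Tendsto.const_mul (a := c) (hρ.tendsto_mass a ha) (Or.inl one_ne_zero)
    rw [mul_one] at h
    filter_upwards [h.eventually_const_lt hbc] with ε hε
    refine hε.trans_le ?_
    rw [← lintegral_const_mul' _ _ (ne_top_of_lt hcA)]
    refine (setLIntegral_mono' measurableSet_Ioo fun t ht => ?_).trans
      (lintegral_mono_set (Ioo_subset_Ioo_right ha.2.le))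
    rw [mul_comm]
    gcongr
    exact (hac t ht).le
  · obtain ⟨c, hAc, hcb⟩ := exists_between hb
    obtain ⟨a, ha, hac⟩ := hnear (hΦ.eventually_lt_const hAc)
    have h := (ENNReal.Tendsto.const_mul (a := M) (hρ.tendsto_tail ha) (Or.inr hM)).const_add c
    rw [mul_zero, add_zero] at h
    filter_upwards [h.eventually_lt_const hcb, self_mem_nhdsWithin] with ε hε hε0
    refine lt_of_le_of_lt ?_ hε
    rw [← Ioo_union_Ico_eq_Ioo ha.1 ha.2.le, lintegral_union measurableSet_Ico
      (disjoint_left.2 fun x hx hx' => absurd hx.2 (not_lt.2 hx'.1))]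
    refine add_le_add ?_ ?_
    · calc ∫⁻ t in Ioo 0 a, ENNReal.ofReal (ρ ε t) * Φ t
          ≤ ∫⁻ t in Ioo 0 a, c * ENNReal.ofReal (ρ ε t) := by
            refine setLIntegral_mono' measurableSet_Ioo fun t ht => ?_
            rw [mul_comm]
            gcongr
            exact (hac t ht).le
        _ = c * ∫⁻ t in Ioo 0 a, ENNReal.ofReal (ρ ε t) := lintegral_const_mul' _ _ hcb.ne_top
        _ ≤ c * 1 := by
            gcongr
            rw [← hρ.mass_eq_one ε hε0]
            exact lintegral_mono_set (Ioo_subset_Ioo_right ha.2.le)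
        _ = c := mul_one c
    · rw [← lintegral_const_mul' _ _ hM]
      refine setLIntegral_mono' measurableSet_Ico fun t ht => ?_
      rw [mul_comm]
      gcongr
      exact hΦM t ⟨ha.1.trans_le ht.1, ht.2⟩

end IsConcentrating

/-! ### The limit of the rearrangement functionals -/

lemma one_lt_one_sub_log {t : ℝ} (ht : t ∈ Ioo (0 : ℝ) 1) : 1 < 1 - Real.log t := by
  linarith [Real.log_neg ht.1 ht.2]

/-- For `u` above `1 / (1 - log t)` the weight `u ^ (-p)` is at most `(1 - log t) ^ p`, so the
total mass of `ρ` bounds `Υ`. -/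
lemma upsilon_le {p : ℝ} (hp : 0 ≤ p) {ρ : ℝ → ℝ} (hρ : ∫⁻ u in Ioo 0 1, ENNReal.ofReal (ρ u) = 1)
    {t : ℝ} (ht : t ∈ Ioo (0 : ℝ) 1) : upsilon p ρ t ≤ ENNReal.ofReal ((1 - Real.log t) ^ p) := by
  have hw := one_lt_one_sub_log ht
  set w := 1 - Real.log t with hwdef
  have hw0 : 0 < w := by linarith
  have hwi : w⁻¹ < 1 := inv_lt_one_of_one_lt₀ hw
  have hwi0 : 0 < w⁻¹ := by positivity
  have hsecond : ∫⁻ u in Ioo w⁻¹ 1, ENNReal.ofReal (ρ u / u ^ p)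
      ≤ ENNReal.ofReal (w ^ p) * ∫⁻ u in Ioo w⁻¹ 1, ENNReal.ofReal (ρ u) := by
    rw [← lintegral_const_mul' _ _ ENNReal.ofReal_ne_top]
    refine setLIntegral_mono' measurableSet_Ioo fun u hu => ?_
    have hu0 : 0 < u := hwi0.trans hu.1
    rw [div_eq_inv_mul, ENNReal.ofReal_mul (by positivity)]
    gcongr
    rw [← Real.inv_rpow hu0.le]
    exact Real.rpow_le_rpow (by positivity) (inv_le_of_inv_le₀ hw0 hu.1.le) hp
  calc upsilon p ρ t
      ≤ ENNReal.ofReal (w ^ p) * (∫⁻ u in Ioo 0 w⁻¹, ENNReal.ofReal (ρ u))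
        + ENNReal.ofReal (w ^ p) * ∫⁻ u in Ioo w⁻¹ 1, ENNReal.ofReal (ρ u) :=
        add_le_add le_rfl hsecond
    _ = ENNReal.ofReal (w ^ p) * ∫⁻ u in Ioo 0 w⁻¹ ∪ Ioo w⁻¹ 1, ENNReal.ofReal (ρ u) := by
        rw [lintegral_union measurableSet_Ioo
          (disjoint_left.2 fun x hx hx' => lt_asymm hx.2 hx'.1), mul_add]
    _ ≤ ENNReal.ofReal (w ^ p) * ∫⁻ u in Ioo 0 1, ENNReal.ofReal (ρ u) := by
        gcongr
        exact union_subset (Ioo_subset_Ioo_right hwi.le) (Ioo_subset_Ioo_left hwi0.le)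
    _ = ENNReal.ofReal (w ^ p) := by rw [hρ, mul_one]

lemma le_upsilon {p : ℝ} {ρ : ℝ → ℝ} {δ t : ℝ} (hδ : δ ∈ Ioo (0 : ℝ) 1) (ht : t ∈ Ioo δ 1) :
    ENNReal.ofReal ((1 - Real.log t) ^ p)
      * (∫⁻ u in Ioo 0 (1 - Real.log δ)⁻¹, ENNReal.ofReal (ρ u)) ≤ upsilon p ρ t := by
  refine le_trans ?_ le_self_add
  have hδ1 := one_lt_one_sub_log hδ
  have ht1 := one_lt_one_sub_log ⟨hδ.1.trans ht.1, ht.2⟩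
  gcongr
  · exact hδ.1
  · exact ht.1.le

/-- For any profile `F`, the functionals `∫ F ^ p Υ_ε` converge to the Zygmund functional of `F`,
also when the latter is infinite. -/
lemma tendsto_lintegral_upsilon {p : ℝ} (hp : 0 ≤ p) {ρ : ℝ → ℝ → ℝ} (hρ : IsConcentrating ρ)
    (F : ℝ → ℝ≥0∞) :
    Tendsto (fun ε => ∫⁻ t in Ioo (0 : ℝ) 1, F t ^ p * upsilon p (ρ ε) t) (𝓝[>] 0)
      (𝓝 (∫⁻ t in Ioo (0 : ℝ) 1, (ENNReal.ofReal (1 - Real.log t) * F t) ^ p)) := by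
  have hpow : ∀ t ∈ Ioo (0 : ℝ) 1, (ENNReal.ofReal (1 - Real.log t) * F t) ^ p
      = F t ^ p * ENNReal.ofReal ((1 - Real.log t) ^ p) := fun t ht => by
    rw [ENNReal.mul_rpow_of_nonneg _ _ hp,
      ENNReal.ofReal_rpow_of_pos (by linarith [one_lt_one_sub_log ht]), mul_comm]
  refine tendsto_order.2 ⟨fun b hb => ?_, fun b hb => ?_⟩
  · have hU : Ioo (0 : ℝ) 1 = ⋃ n : ℕ, Ioo (1 / ((n : ℝ) + 2)) 1 := by
      ext t
      simp only [mem_iUnion, mem_Ioo, exists_and_right]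
      refine and_congr_left fun ht => ⟨fun h => ?_, fun ⟨n, hn⟩ => lt_trans (by positivity) hn⟩
      obtain ⟨n, hn⟩ := exists_nat_one_div_lt h
      exact ⟨n, lt_of_le_of_lt (one_div_le_one_div_of_le (by positivity) (by linarith)) hn⟩
    rw [hU, setLIntegral_iUnion_of_directed, lt_iSup_iff] at hb
    · obtain ⟨n, hn⟩ := hb
      have hδ : 1 / ((n : ℝ) + 2) ∈ Ioo (0 : ℝ) 1 := by
        refine ⟨by positivity, ?_⟩
        rw [div_lt_one (by positivity)]
        have : (0 : ℝ) ≤ n := n.cast_nonneg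
        linarith
      set δ := 1 / ((n : ℝ) + 2)
      have hδ1 := one_lt_one_sub_log hδ
      have h := ENNReal.Tendsto.const_mul (hρ.tendsto_mass (1 - Real.log δ)⁻¹
        ⟨by positivity, inv_lt_one_of_one_lt₀ hδ1⟩) (Or.inl one_ne_zero)
        (a := ∫⁻ t in Ioo δ 1, (ENNReal.ofReal (1 - Real.log t) * F t) ^ p)
      rw [mul_one] at h
      filter_upwards [h.eventually_const_lt hn, self_mem_nhdsWithin] with ε hε hε0
      refine hε.trans_le ?_
      have hm : ∫⁻ u in Ioo 0 (1 - Real.log δ)⁻¹, ENNReal.ofReal (ρ ε u) ≠ ⊤ := by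
        refine ne_top_of_le_ne_top ENNReal.one_ne_top ?_
        rw [← hρ.mass_eq_one ε hε0]
        exact lintegral_mono_set (Ioo_subset_Ioo_right (inv_le_one_of_one_le₀ hδ1.le))
      rw [← lintegral_mul_const' _ _ hm]
      refine (setLIntegral_mono' measurableSet_Ioo fun t ht => ?_).trans
        (lintegral_mono_set (Ioo_subset_Ioo_left hδ.1.le))
      rw [hpow t ⟨hδ.1.trans ht.1, ht.2⟩, mul_assoc]
      gcongr
      exact le_upsilon hδ ht
    · refine Monotone.directed_le fun m n hmn => Ioo_subset_Ioo_left ?_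
      exact one_div_le_one_div_of_le (by positivity) (by gcongr)
  · filter_upwards [self_mem_nhdsWithin] with ε hε
    refine lt_of_le_of_lt (setLIntegral_mono' measurableSet_Ioo fun t ht => ?_) hb
    rw [hpow t ht]
    gcongr
    exact upsilon_le hp (hρ.mass_eq_one ε hε) ht

lemma zygmundNorm_rpow {N : ℕ} {p : ℝ} (hp : 0 < p) (f : Space N → ℝ) :
    zygmundNorm p f ^ p
      = ∫⁻ t in Ioo (0 : ℝ) 1, (ENNReal.ofReal (1 - Real.log t) * rearrangement f t) ^ p := by
  rw [zygmundNorm, ← ENNReal.rpow_mul, one_div, inv_mul_cancel₀ hp.ne', ENNReal.rpow_one]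

/-! ### The Gauss measure and the Mehler flow -/

/-- The density of the Gauss measure with respect to Lebesgue measure. -/
def gaussDensity (N : ℕ) (x : Space N) : ℝ :=
  (2 * Real.pi) ^ (-(N : ℝ) / 2) * Real.exp (-‖x‖ ^ 2 / 2)

lemma gaussDensity_nonneg {N : ℕ} (x : Space N) : 0 ≤ gaussDensity N x := by
  unfold gaussDensity; positivity

lemma continuous_gaussDensity (N : ℕ) : Continuous (gaussDensity N) := by
  unfold gaussDensity; fun_prop

/-- Valid for every `g`, integrable or not, with the usual conventions for Bochner integrals. -/
lemma integral_gaussMeasure {N : ℕ} {E : Type*} [NormedAddCommGroup E] [NormedSpace ℝ E]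
    (g : Space N → E) : ∫ x, g x ∂gaussMeasure N = ∫ x, gaussDensity N x • g x := by
  have hγ : gaussMeasure N = volume.withDensity fun x => ENNReal.ofReal (gaussDensity N x) := rfl
  rw [hγ, integral_withDensity_eq_integral_toReal_smul₀
    (f := fun x => ENNReal.ofReal (gaussDensity N x))
    (continuous_gaussDensity N).measurable.ennreal_ofReal.aemeasurable
    (ae_of_all _ fun _ => ENNReal.ofReal_lt_top)]
  simp_rw [ENNReal.toReal_ofReal (gaussDensity_nonneg _)]

lemma ofReal_gaussDensity {N : ℕ} (x : Space N) :
    (gaussDensity N x : ℂ)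
      = ((2 * Real.pi : ℝ) ^ (-(N : ℝ) / 2) : ℝ)
        * Complex.exp (-(1 / 2) * ‖x‖ ^ 2 + 0 * inner ℝ 0 x) := by
  rw [gaussDensity]
  push_cast
  congr 2
  ring

lemma integrable_gaussDensity (N : ℕ) : Integrable (gaussDensity N) := by
  have h := (GaussianFourier.integrable_cexp_neg_mul_sq_norm_add (V := Space N) (b := 1 / 2)
    (by norm_num) 0 0).const_mul (((2 * Real.pi : ℝ) ^ (-(N : ℝ) / 2) : ℝ) : ℂ)
  have h2 := h.re
  refine h2.congr (ae_of_all _ fun x => ?_)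
  simp only
  rw [← ofReal_gaussDensity]
  simp

instance isFiniteMeasure_gaussMeasure (N : ℕ) : IsFiniteMeasure (gaussMeasure N) :=
  isFiniteMeasure_withDensity_ofReal (integrable_gaussDensity N).2

lemma gaussMeasure_eq_stdGaussian (N : ℕ) :
    gaussMeasure N = ProbabilityTheory.stdGaussian (Space N) := by
  refine Measure.ext_of_charFun (funext fun t => ?_)
  rw [ProbabilityTheory.charFun_stdGaussian, charFun_apply, integral_gaussMeasure]
  have h := GaussianFourier.integral_cexp_neg_mul_sq_norm_add (V := Space N) (b := 1 / 2)
    (by norm_num) Complex.I t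
  have hfr : Module.finrank ℝ (Space N) = N := by simp
  rw [hfr] at h
  have hfun : ∀ x : Space N, gaussDensity N x • Complex.exp (inner ℝ x t * Complex.I)
      = (((2 * Real.pi : ℝ) ^ (-(N : ℝ) / 2) : ℝ) : ℂ)
        * Complex.exp (-(1 / 2) * ‖x‖ ^ 2 + Complex.I * inner ℝ t x) := fun x => by
    rw [Complex.real_smul, ofReal_gaussDensity, mul_assoc, ← Complex.exp_add, real_inner_comm x t]
    congr 2
    ring
  simp_rw [hfun]
  rw [integral_const_mul, h]
  have hpi : ((2 * Real.pi : ℝ) ^ (-(N : ℝ) / 2) : ℝ)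
      * ((2 * Real.pi : ℝ) ^ ((N : ℝ) / 2) : ℝ) = 1 := by
    rw [← Real.rpow_add (by positivity)]
    ring_nf
    simp
  have hpi2 : ((Real.pi : ℂ) / (1 / 2)) ^ ((N : ℂ) / 2)
      = (((2 * Real.pi : ℝ) ^ ((N : ℝ) / 2) : ℝ) : ℂ) := by
    rw [Complex.ofReal_cpow (by positivity)]
    push_cast
    congr 1
    ring
  rw [hpi2, ← mul_assoc, ← Complex.ofReal_mul, hpi, Complex.ofReal_one, one_mul, Complex.I_sq]
  congr 1
  ring

instance isGaussian_gaussMeasure (N : ℕ) : ProbabilityTheory.IsGaussian (gaussMeasure N) := by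
  rw [gaussMeasure_eq_stdGaussian]; infer_instance

/-- `√(1 - e^{-2s})`, the standard deviation of the noise in the Mehler flow. -/
def noise (s : ℝ) : ℝ := √(1 - Real.exp (-2 * s))

lemma noise_sq {s : ℝ} (hs : 0 ≤ s) : noise s ^ 2 = 1 - Real.exp (-2 * s) :=
  Real.sq_sqrt (by simpa using hs)

lemma exp_sq_add_noise_sq {s : ℝ} (hs : 0 ≤ s) : Real.exp (-s) ^ 2 + noise s ^ 2 = 1 := by
  rw [noise_sq hs, ← Real.exp_nat_mul]
  push_cast
  ring_nf

@[fun_prop]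
lemma continuous_noise : Continuous noise := by unfold noise; fun_prop

/-- The Mehler flow: if `x` and `z` are independent standard Gaussian vectors, `mehler s (x, z)` is
the position at time `s` of the Ornstein-Uhlenbeck process that starts at `x`, driven by `z`. -/
def mehler {N : ℕ} (s : ℝ) (q : Space N × Space N) : Space N :=
  Real.exp (-s) • q.1 + noise s • q.2

/-- The reflection `(x, z) ↦ (mehler s (x, z), noise s • x - e^{-s} z)` of `ℝ^N × ℝ^N`. It exchanges
the initial and the final position of the Mehler flow. -/
def mehlerReflection {N : ℕ} (s : ℝ) (q : Space N × Space N) : Space N × Space N :=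
  (mehler s q, noise s • q.1 - Real.exp (-s) • q.2)

lemma mehler_mehlerReflection {N : ℕ} {s : ℝ} (hs : 0 ≤ s) (q : Space N × Space N) :
    mehler s (mehlerReflection s q) = q.1 := by
  have h := exp_sq_add_noise_sq hs
  simp only [mehlerReflection, mehler, smul_add, smul_sub, smul_smul]
  rw [mul_comm (noise s) (Real.exp (-s))]
  calc _ = (Real.exp (-s) ^ 2 + noise s ^ 2) • q.1 := by module
    _ = q.1 := by rw [h, one_smul]

lemma measurePreserving_mehlerReflection {N : ℕ} {s : ℝ} (hs : 0 ≤ s) :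
    MeasurePreserving (mehlerReflection (N := N) s) ((gaussMeasure N).prod (gaussMeasure N))
      ((gaussMeasure N).prod (gaussMeasure N)) := by
  have hrot : MeasurePreserving (ContinuousLinearMap.rotation (E := Space N)
      (Real.arccos (Real.exp (-s)))) ((gaussMeasure N).prod (gaussMeasure N))
      ((gaussMeasure N).prod (gaussMeasure N)) := by
    refine ⟨by fun_prop, ?_⟩
    refine ProbabilityTheory.IsGaussian.map_rotation_eq_self_of_forall_strongDual_eq_zero ?_ _
    rw [gaussMeasure_eq_stdGaussian]
    exact ProbabilityTheory.integral_strongDual_stdGaussian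
  have hneg : MeasurePreserving (fun z : Space N => -z) (gaussMeasure N) (gaussMeasure N) := by
    refine ⟨measurable_neg, ?_⟩
    rw [gaussMeasure_eq_stdGaussian]
    exact ProbabilityTheory.stdGaussian_map (LinearIsometryEquiv.neg ℝ (E := Space N))
  have h := ((MeasurePreserving.id (gaussMeasure N)).prod hneg).comp hrot
  have hc : Real.cos (Real.arccos (Real.exp (-s))) = Real.exp (-s) :=
    Real.cos_arccos (by linarith [Real.exp_pos (-s)]) (by simpa using hs)
  have hsin : Real.sin (Real.arccos (Real.exp (-s))) = noise s := by
    rw [Real.sin_arccos, noise, ← Real.exp_nat_mul]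
    push_cast
    ring_nf
  convert! h using 1
  ext1 q
  simp only [Function.comp_apply, Prod.map, ContinuousLinearMap.rotation_apply, hc, hsin,
    mehlerReflection, mehler, id]
  congr 1
  module

/-- Mehler's formula. -/
lemma ouSemigroup_eq_integral_mehler {N : ℕ} {s : ℝ} (hs : 0 < s) (f : Space N → ℝ) (x : Space N) :
    ouSemigroup s f x = ∫ z, f (mehler s (x, z)) ∂gaussMeasure N := by
  have hσ2 := noise_sq hs.le
  have h1 : Real.exp (-2 * s) < 1 := by simpa using hs
  have hσ : 0 < noise s := Real.sqrt_pos.2 (by linarith)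
  have hexp : Real.exp (-2 * s) = Real.exp (-s) ^ 2 := by
    rw [← Real.exp_nat_mul]; push_cast; ring_nf
  set e := Real.exp (-s)
  set σ := noise s
  rw [integral_gaussMeasure]
  -- Substitute `y = e x + σ z`: the kernel times the Gaussian density at `y` is `σ⁻ᴺ` times the
  -- density at `z`.
  have hcov := integral_add_right_eq_self (μ := (volume : Measure (Space N)))
    (fun y => gaussDensity N (σ⁻¹ • (y - e • x)) • f y) (e • x)
  have hcov2 := Measure.integral_comp_inv_smul (volume : Measure (Space N))
    (fun z => gaussDensity N z • f (mehler s (x, z))) σ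
  have hfr : Module.finrank ℝ (Space N) = N := by simp
  rw [hfr, abs_of_pos (by positivity)] at hcov2
  have hcov3 : ∫ y, gaussDensity N (σ⁻¹ • (y - e • x)) • f y
      = σ ^ N • ∫ z, gaussDensity N z • f (mehler s (x, z)) := by
    rw [← hcov2, ← hcov]
    congr 1
    ext1 y
    rw [add_sub_cancel_right, mehler, smul_smul, mul_inv_cancel₀ hσ.ne', one_smul, add_comm y]
  have hpow : (1 - Real.exp (-2 * s)) ^ (-(N : ℝ) / 2) = (σ ^ N)⁻¹ := by
    rw [← hσ2, ← Real.rpow_natCast, ← Real.rpow_natCast, ← Real.rpow_mul hσ.le,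
      ← Real.rpow_neg hσ.le]
    congr 1
    push_cast
    ring
  rw [ouSemigroup, hpow, eq_comm]
  rw [smul_eq_mul] at hcov3
  rw [eq_inv_mul_iff_mul_eq₀ (by positivity), ← hcov3, integral_gaussMeasure]
  congr 1
  ext1 y
  simp only [gaussDensity, smul_eq_mul, norm_smul, norm_inv, Real.norm_of_nonneg hσ.le, mul_pow]
  rw [← mul_assoc, mul_assoc _ (Real.exp _) (Real.exp _), ← Real.exp_add, ← hσ2, hexp]
  congr 3
  have hn : ‖y - e • x‖ ^ 2 = ‖y‖ ^ 2 - 2 * (e * inner ℝ x y) + e ^ 2 * ‖x‖ ^ 2 := by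
    rw [norm_sub_sq_real, inner_smul_right, norm_smul, mul_pow, Real.norm_eq_abs, sq_abs,
      real_inner_comm]
  have he2 : e ^ 2 = 1 - σ ^ 2 := by rw [hσ2, hexp]; ring
  rw [hn]
  field_simp
  rw [he2]
  ring

lemma integral_cos_gaussMeasure {N : ℕ} (η : Space N) (c : ℝ) :
    ∫ z, Real.cos (inner ℝ η z + c) ∂gaussMeasure N = Real.exp (-‖η‖ ^ 2 / 2) * Real.cos c := by
  have h := ProbabilityTheory.charFun_stdGaussian (E := Space N) η
  rw [← gaussMeasure_eq_stdGaussian, charFun_apply] at h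
  have hint : Integrable (fun z : Space N => Complex.exp ((inner ℝ η z + c : ℝ) * Complex.I))
      (gaussMeasure N) := by
    refine Integrable.of_bound (C := 1) (by fun_prop) (ae_of_all _ fun z => ?_)
    rw [Complex.norm_exp_ofReal_mul_I]
  have h2 : ∫ z, Complex.exp ((inner ℝ η z + c : ℝ) * Complex.I) ∂gaussMeasure N
      = ((Real.exp (-‖η‖ ^ 2 / 2) : ℝ) : ℂ) * Complex.exp (c * Complex.I) := by
    rw [Complex.ofReal_exp]
    push_cast
    rw [← h, ← integral_mul_const]
    congr 1
    ext1 z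
    rw [← Complex.exp_add, real_inner_comm]
    congr 1
    ring
  have h3 := congrArg Complex.re h2
  rw [Complex.re_ofReal_mul, Complex.exp_ofReal_mul_I_re] at h3
  rw [← h3]
  refine Eq.trans ?_ (integral_re hint)
  simp only [RCLike.re_to_complex, Complex.exp_ofReal_mul_I_re]

/-! ### The distributional equation for smooth functions with bounded derivatives -/

lemma ouOperator_eq_sum {N : ℕ} (φ : Space N → ℝ) (x : Space N) :
    ouOperator φ x = ∑ i, iteratedFDeriv ℝ 2 φ x
      ![stdOrthonormalBasis ℝ (Space N) i, stdOrthonormalBasis ℝ (Space N) i] - fderiv ℝ φ x x := by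
  rw [ouOperator, InnerProductSpace.laplacian_eq_iteratedFDeriv_stdOrthonormalBasis,
    inner_gradient_right]
  simp

lemma abs_ouOperator_le {N : ℕ} (φ : Space N → ℝ) (x : Space N) :
    |ouOperator φ x| ≤ N * ‖iteratedFDeriv ℝ 2 φ x‖ + ‖x‖ * ‖iteratedFDeriv ℝ 1 φ x‖ := by
  rw [ouOperator_eq_sum]
  refine (abs_sub _ _).trans (add_le_add ?_ ?_)
  · refine (Finset.abs_sum_le_sum_abs _ _).trans ?_
    refine (Finset.sum_le_card_nsmul _ _ ‖iteratedFDeriv ℝ 2 φ x‖ fun i _ => ?_).trans ?_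
    · rw [← Real.norm_eq_abs]
      refine (ContinuousMultilinearMap.le_opNorm _ _).trans ?_
      simp [Fin.prod_univ_two]
    · simp
  · rw [norm_iteratedFDeriv_one, mul_comm]
    exact (fderiv ℝ φ x).le_opNorm x

lemma continuous_ouOperator {N : ℕ} {φ : Space N → ℝ} (hφ : ContDiff ℝ ∞ φ) :
    Continuous (ouOperator φ) := by
  have h2 : ∀ k : ℕ, Continuous (iteratedFDeriv ℝ k φ) := fun k =>
    hφ.continuous_iteratedFDeriv (by exact_mod_cast le_top)
  specialize h2 2
  have h1 : Continuous (fderiv ℝ φ) := hφ.continuous_fderiv (by simp)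
  have : ouOperator φ = _ := funext (ouOperator_eq_sum φ)
  rw [this]
  fun_prop

lemma ouOperator_congr_nhds {N : ℕ} {φ ψ : Space N → ℝ} {x : Space N} (h : φ =ᶠ[𝓝 x] ψ) :
    ouOperator φ x = ouOperator ψ x := by
  rw [ouOperator, ouOperator, h.gradient_eq,
    (InnerProductSpace.laplacian_congr_nhds h).eq_of_nhds]

/-- A function in `L^p(γ_N)` with `p > 1` is integrable against functions of linear growth. -/
lemma integrable_mul_one_add_norm {N : ℕ} {p : ℝ} (hp : 1 < p) {f : Space N → ℝ}
    (hf : MemLp f (ENNReal.ofReal p) (gaussMeasure N)) :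
    Integrable (fun x => f x * (1 + ‖x‖)) (gaussMeasure N) := by
  have hq := (Real.HolderConjugate.conjExponent hp).ennrealOfReal
  have hid := ProbabilityTheory.IsGaussian.memLp_id (gaussMeasure N)
    (ENNReal.ofReal p.conjExponent) ENNReal.ofReal_ne_top
  exact hf.integrable_mul ((memLp_const (1 : ℝ)).add hid.norm)

/-- The distributional equation may be tested with smooth functions that are bounded together with
their first two derivatives: cut `ψ` off outside a large ball. On the ball nothing changes, and
outside it `𝓛` of the truncation has linear growth uniformly in the radius. -/
lemma HasOU.integral_eq_of_bounded {N : ℕ} {p : ℝ} (hp : 1 < p) {f h : Space N → ℝ}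
    (H : HasOU p f h) {ψ : Space N → ℝ} (hψ : ContDiff ℝ ∞ ψ) {C : ℝ}
    (hC : ∀ i ≤ 2, ∀ x, ‖iteratedFDeriv ℝ i ψ x‖ ≤ C) :
    ∫ x, f x * ouOperator ψ x ∂gaussMeasure N = ∫ x, h x * ψ x ∂gaussMeasure N := by
  let χ : ContDiffBump (0 : Space N) := ⟨1, 2, one_pos, one_lt_two⟩
  have hχ : ContDiff ℝ ∞ χ := χ.contDiff
  obtain ⟨D, hD⟩ : ∃ D, ∀ i ≤ 2, ∀ x, ‖iteratedFDeriv ℝ i χ x‖ ≤ D := by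
    have h : ∀ i : ℕ, ∃ D, ∀ x, ‖iteratedFDeriv ℝ i χ x‖ ≤ D := fun i =>
      (χ.hasCompactSupport.iteratedFDeriv i).exists_bound_of_continuous
        (hχ.continuous_iteratedFDeriv (by exact_mod_cast le_top))
    choose D hD using h
    refine ⟨max (D 0) (max (D 1) (D 2)), fun i hi x => (hD i x).trans ?_⟩
    interval_cases i <;> simp
  have hC0 : 0 ≤ C := (norm_nonneg _).trans (hC 0 (by norm_num) 0)
  have hD0 : 0 ≤ D := (norm_nonneg _).trans (hD 0 (by norm_num) 0)
  let r : ℕ → ℝ := fun n => ((n : ℝ) + 1)⁻¹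
  have hr0 : ∀ n, 0 < r n := fun n => by positivity
  have hr1 : ∀ n, r n ≤ 1 := fun n => inv_le_one_of_one_le₀ (by simp)
  have hrlim : Tendsto r atTop (𝓝 0) :=
    tendsto_inv_atTop_zero.comp (tendsto_natCast_atTop_atTop.atTop_add tendsto_const_nhds)
  let χn : ℕ → Space N → ℝ := fun n x => χ (r n • x)
  have hχn : ∀ n, ContDiff ℝ ∞ (χn n) := fun n => hχ.comp (contDiff_const_smul _)
  let φ : ℕ → Space N → ℝ := fun n x => ψ x * χn n x
  have hφ : ∀ n, ContDiff ℝ ∞ (φ n) := fun n => hψ.mul (hχn n)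
  have hφs : ∀ n, HasCompactSupport (φ n) := fun n =>
    (χ.hasCompactSupport.comp_smul (hr0 n).ne').mul_left
  have hDn : ∀ n, ∀ i ≤ 2, ∀ x, ‖iteratedFDeriv ℝ i (χn n) x‖ ≤ D := fun n i hi x => by
    rw [iteratedFDeriv_comp_const_smul _ (hχ.of_le (by exact_mod_cast le_top)), norm_smul,
      Real.norm_of_nonneg (pow_nonneg (hr0 n).le _)]
    refine (mul_le_of_le_one_left (norm_nonneg _) (pow_le_one₀ (hr0 n).le (hr1 n))).trans ?_
    exact hD i hi _
  have hB : ∀ n, ∀ i ≤ 2, ∀ x, ‖iteratedFDeriv ℝ i (φ n) x‖ ≤ 4 * C * D := fun n i hi x => by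
    refine (norm_iteratedFDeriv_mul_le hψ (hχn n) x (n := i)
      (by exact_mod_cast le_top)).trans ?_
    calc _ ≤ ∑ j ∈ Finset.range (i + 1), (i.choose j : ℝ) * C * D := by
          refine Finset.sum_le_sum fun j hj => ?_
          have hj' := Finset.mem_range.1 hj
          gcongr
          · exact hC j (by omega) x
          · exact hDn n _ (by omega) x
      _ = 2 ^ i * C * D := by
          rw [← Finset.sum_mul, ← Finset.sum_mul]
          exact_mod_cast congrArg (fun k : ℕ => (k : ℝ) * C * D) (Nat.sum_range_choose i)
      _ ≤ 4 * C * D := by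
          gcongr
          calc (2 : ℝ) ^ i ≤ 2 ^ 2 := pow_le_pow_right₀ (by norm_num) hi
            _ = 4 := by norm_num
  have hev : ∀ x, ∀ᶠ n in atTop, χn n =ᶠ[𝓝 x] fun _ => 1 := fun x => by
    have h1 : Tendsto (fun n => r n • x) atTop (𝓝 0) := by simpa using hrlim.smul_const x
    filter_upwards [h1.eventually (Metric.ball_mem_nhds 0 one_pos)] with n hn
    exact (continuous_const_smul (r n)).continuousAt.eventually
      (χ.eventuallyEq_one_of_mem_ball hn)
  have hlim1 : Tendsto (fun n => ∫ x, f x * ouOperator (φ n) x ∂gaussMeasure N) atTop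
      (𝓝 (∫ x, f x * ouOperator ψ x ∂gaussMeasure N)) := by
    refine tendsto_integral_of_dominated_convergence
      (fun x => ((N + 1) * (4 * C * D)) * ‖f x * (1 + ‖x‖)‖) (fun n => ?_)
      ((integrable_mul_one_add_norm hp H.memLp).norm.const_mul _) (fun n => ?_) ?_
    · exact H.memLp.1.mul (continuous_ouOperator (hφ n)).aestronglyMeasurable
    · refine ae_of_all _ fun x => ?_
      have h1 : |ouOperator (φ n) x| ≤ (N + 1) * (4 * C * D) * (1 + ‖x‖) := by
        refine (abs_ouOperator_le _ _).trans ?_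
        calc N * ‖iteratedFDeriv ℝ 2 (φ n) x‖ + ‖x‖ * ‖iteratedFDeriv ℝ 1 (φ n) x‖
            ≤ N * (4 * C * D) + ‖x‖ * (4 * C * D) := by
              gcongr
              · exact hB n 2 le_rfl x
              · exact hB n 1 one_le_two x
          _ ≤ N * (4 * C * D) + ‖x‖ * (4 * C * D) + (N * ‖x‖ + 1) * (4 * C * D) :=
              le_add_of_nonneg_right (by positivity)
          _ = (N + 1) * (4 * C * D) * (1 + ‖x‖) := by ring
      rw [norm_mul, norm_mul, Real.norm_eq_abs (ouOperator _ _),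
        Real.norm_of_nonneg (by positivity : 0 ≤ 1 + ‖x‖), mul_left_comm]
      gcongr
    · refine ae_of_all _ fun x => tendsto_const_nhds.congr' ?_
      filter_upwards [hev x] with n hn
      rw [ouOperator_congr_nhds (x := x) (φ := φ n) (ψ := ψ)]
      filter_upwards [hn] with y hy
      simp [φ, hy]
  have hlim2 : Tendsto (fun n => ∫ x, h x * φ n x ∂gaussMeasure N) atTop
      (𝓝 (∫ x, h x * ψ x ∂gaussMeasure N)) := by
    refine tendsto_integral_of_dominated_convergence (fun x => ‖h x‖ * C) (fun n => ?_)
      ((H.memLp_image.integrable (by simpa using hp.le)).norm.mul_const _) (fun n => ?_) ?_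
    · exact H.memLp_image.1.mul (hφ n).continuous.aestronglyMeasurable
    · refine ae_of_all _ fun x => ?_
      rw [norm_mul, norm_mul]
      have h1 : ‖χn n x‖ ≤ 1 := by
        rw [Real.norm_of_nonneg χ.nonneg]; exact χ.le_one
      have h2 : ‖ψ x‖ ≤ C := by simpa using hC 0 (by norm_num) x
      gcongr
      exact (mul_le_of_le_one_right (norm_nonneg _) h1).trans h2
    · refine ae_of_all _ fun x => tendsto_const_nhds.congr' ?_
      filter_upwards [hev x] with n hn
      simp [φ, hn.eq_of_nhds]
  refine tendsto_nhds_unique hlim1 (hlim2.congr fun n => ?_)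
  exact (H.integral_eq (φ n) (hφ n) (hφs n)).symm

/-- The plane wave `x ↦ cos (η · x + c)`. -/
def wave {N : ℕ} (η : Space N) (c : ℝ) (x : Space N) : ℝ := Real.cos (inner ℝ η x + c)

lemma contDiff_wave {N : ℕ} (η : Space N) (c : ℝ) : ContDiff ℝ ∞ (wave η c) := by
  
  exact Real.contDiff_cos.comp ((innerSL ℝ η).contDiff.add contDiff_const)

lemma abs_wave_le {N : ℕ} (η : Space N) (c : ℝ) (x : Space N) : |wave η c x| ≤ 1 :=
  Real.abs_cos_le_one _

lemma norm_iteratedFDeriv_wave_le {N : ℕ} (η : Space N) (c : ℝ) (i : ℕ) (x : Space N) :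
    ‖iteratedFDeriv ℝ i (wave η c) x‖ ≤ ‖η‖ ^ i := by
  have h : wave η c = (fun u : ℝ => Real.cos (u + c)) ∘ innerSL ℝ η := rfl
  have hc : ContDiff ℝ ∞ fun u : ℝ => Real.cos (u + c) := by fun_prop
  rw [h, ContinuousLinearMap.iteratedFDeriv_comp_right _ hc _ (by exact_mod_cast le_top)]
  refine (ContinuousMultilinearMap.norm_compContinuousLinearMap_le _ _).trans ?_
  rw [norm_iteratedFDeriv_eq_norm_iteratedDeriv, iteratedDeriv_comp_add_const]
  simp only [innerSL_apply_norm, Finset.prod_const, Finset.card_univ, Fintype.card_fin]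
  exact mul_le_of_le_one_left (by positivity) (Real.abs_iteratedDeriv_cos_le_one i _)

lemma ouOperator_wave {N : ℕ} (η : Space N) (c : ℝ) (x : Space N) :
    ouOperator (wave η c) x
      = -‖η‖ ^ 2 * wave η c x + inner ℝ η x * Real.sin (inner ℝ η x + c) := by
  have h1 : ∀ y, HasFDerivAt (wave η c) (-Real.sin (inner ℝ η y + c) • innerSL ℝ η) y := fun y =>
    (((innerSL ℝ η).hasFDerivAt (x := y)).add_const c).cos
  have h1' : fderiv ℝ (wave η c) = fun y => -Real.sin (inner ℝ η y + c) • innerSL ℝ η :=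
    funext fun y => (h1 y).fderiv
  have h2 : ∀ y, HasFDerivAt (fun y => -Real.sin (inner ℝ η y + c) • innerSL ℝ η)
      ((-(Real.cos (inner ℝ η y + c) • innerSL ℝ η)).smulRight (innerSL ℝ η)) y := fun y =>
    HasFDerivAt.smul_const (c := fun y => -Real.sin (inner ℝ η y + c))
      (((innerSL ℝ η).hasFDerivAt (x := y)).add_const c).sin.neg (innerSL ℝ η)
  rw [ouOperator_eq_sum]
  simp_rw [iteratedFDeriv_two_apply, h1', (h2 _).fderiv]
  have h3 := (stdOrthonormalBasis ℝ (Space N)).sum_sq_inner_left η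
  simp only [Matrix.cons_val_zero, Matrix.cons_val_one, ContinuousLinearMap.smulRight_apply,
    FunLike.coe_smul, FunLike.coe_neg, Pi.smul_apply, Pi.neg_apply,
    innerSL_apply_apply, smul_eq_mul, wave]
  simp_rw [neg_mul, mul_assoc, ← sq]
  rw [Finset.sum_neg_distrib, ← Finset.mul_sum, h3]
  ring

lemma HasOU.integral_wave {N : ℕ} {p : ℝ} (hp : 1 < p) {f h : Space N → ℝ}
    (H : HasOU p f h) (η : Space N) (c : ℝ) :
    ∫ x, f x * ouOperator (wave η c) x ∂gaussMeasure N = ∫ x, h x * wave η c x ∂gaussMeasure N := by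
  refine H.integral_eq_of_bounded hp (contDiff_wave η c) (C := max 1 (‖η‖ ^ 2)) fun i hi x => ?_
  refine (norm_iteratedFDeriv_wave_le η c i x).trans ?_
  rcases le_total ‖η‖ 1 with h1 | h1
  · exact (pow_le_one₀ (norm_nonneg _) h1).trans (le_max_left _ _)
  · exact (pow_le_pow_right₀ h1 hi).trans (le_max_right _ _)

/-! ### Averages over reversible couplings -/

section Coupling

variable {X W : Type*} [MeasurableSpace X] [MeasurableSpace W] {μ : Measure X} {ν : Measure W}
  [IsProbabilityMeasure ν]

/-- If `R` preserves `μ ⊗ ν` and `R (R q)` has the same first coordinate as `q`, then the averaging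
operator `f ↦ ∫ f ((R (·, w)).1) dν(w)` is symmetric. -/
lemma integral_average_mul [IsFiniteMeasure μ] {R : X × W → X × W}
    (hR : MeasurePreserving R (μ.prod ν) (μ.prod ν))
    (hRR : ∀ᵐ q ∂μ.prod ν, (R (R q)).1 = q.1) {f ψ : X → ℝ} (hf : Integrable f μ)
    (hψ : Measurable ψ) (hψ1 : ∀ x, |ψ x| ≤ 1) :
    ∫ x, (∫ w, f (R (x, w)).1 ∂ν) * ψ x ∂μ = ∫ x, f x * ∫ w, ψ (R (x, w)).1 ∂ν ∂μ := by
  -- Disintegrated, both sides are integrals over `X × W`, and the change of variables `R` carries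
  -- one into the other.
  have hS : MeasurePreserving (fun q => (R q).1) (μ.prod ν) μ := measurePreserving_fst.comp hR
  have hint2 : Integrable (fun q : X × W => f q.1 * ψ (R q).1) (μ.prod ν) :=
    (hf.comp_fst ν).mul_bdd (c := 1) (hψ.comp hS.measurable).aestronglyMeasurable
      (ae_of_all _ fun q => hψ1 _)
  have hint1 : Integrable (fun q : X × W => f (R q).1 * ψ q.1) (μ.prod ν) :=
    (hS.integrable_comp_of_integrable hf).mul_bdd (c := 1)
      (hψ.comp measurable_fst).aestronglyMeasurable (ae_of_all _ fun q => hψ1 _)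
  calc ∫ x, (∫ w, f (R (x, w)).1 ∂ν) * ψ x ∂μ
      = ∫ q, f (R q).1 * ψ q.1 ∂μ.prod ν := by
        rw [integral_prod _ hint1]
        simp_rw [integral_mul_const]
    _ = ∫ q, f (R q).1 * ψ (R (R q)).1 ∂μ.prod ν :=
        integral_congr_ae (hRR.mono fun q hq => by simp only [hq])
    _ = ∫ q, f q.1 * ψ (R q).1 ∂μ.prod ν := by
        conv_rhs => rw [← hR.map_eq]
        rw [integral_map hR.aemeasurable (by rw [hR.map_eq]; exact hint2.1)]
    _ = ∫ x, f x * ∫ w, ψ (R (x, w)).1 ∂ν ∂μ := by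
        rw [integral_prod _ hint2]
        simp_rw [integral_const_mul]

/-- Jensen's inequality: averaging in one variable does not increase the `L^p` norm. -/
lemma eLpNorm_integral_prod_le {p : ℝ≥0∞} (hp : 1 ≤ p) (hp' : p ≠ ⊤) {F : X × W → ℝ}
    (hF : AEStronglyMeasurable F (μ.prod ν)) :
    eLpNorm (fun x => ∫ w, F (x, w) ∂ν) p μ ≤ eLpNorm F p (μ.prod ν) := by
  have hp0 : p ≠ 0 := (zero_lt_one.trans_le hp).ne'
  have hpr : 0 < p.toReal := ENNReal.toReal_pos hp0 hp'
  rw [eLpNorm_eq_lintegral_rpow_enorm_toReal hp0 hp',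
    eLpNorm_eq_lintegral_rpow_enorm_toReal hp0 hp',
    lintegral_prod _ (hF.enorm.pow_const _)]
  refine ENNReal.rpow_le_rpow (lintegral_mono_ae ?_) (by positivity)
  filter_upwards [hF.prodMk_left] with x hx
  have h := eLpNorm_le_eLpNorm_of_exponent_le hp hx
  rw [eLpNorm_one_eq_lintegral_enorm, eLpNorm_eq_lintegral_rpow_enorm_toReal hp0 hp'] at h
  calc ‖∫ w, F (x, w) ∂ν‖ₑ ^ p.toReal ≤ (∫⁻ w, ‖F (x, w)‖ₑ ∂ν) ^ p.toReal := by
        gcongr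
        exact enorm_integral_le_lintegral_enorm _
    _ ≤ ((∫⁻ w, ‖F (x, w)‖ₑ ^ p.toReal ∂ν) ^ (1 / p.toReal)) ^ p.toReal := by gcongr
    _ = ∫⁻ w, ‖F (x, w)‖ₑ ^ p.toReal ∂ν := by
        rw [← ENNReal.rpow_mul, one_div, inv_mul_cancel₀ hpr.ne', ENNReal.rpow_one]

end Coupling

/-! ### The semigroup on plane waves -/

/-- The Ornstein-Uhlenbeck evolution of the plane wave `wave ξ c`. -/
def waveEvolution {N : ℕ} (ξ : Space N) (c s : ℝ) (x : Space N) : ℝ :=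
  Real.exp (-‖ξ‖ ^ 2 / 2 * (1 - Real.exp (-2 * s))) * wave (Real.exp (-s) • ξ) c x

lemma waveEvolution_zero {N : ℕ} (ξ : Space N) (c : ℝ) (x : Space N) :
    waveEvolution ξ c 0 x = wave ξ c x := by
  simp [waveEvolution]

lemma continuous_waveEvolution {N : ℕ} (ξ : Space N) (c : ℝ) :
    Continuous (fun q : ℝ × Space N => waveEvolution ξ c q.1 q.2) := by
  unfold waveEvolution wave
  fun_prop

lemma integral_wave_mehler {N : ℕ} {s : ℝ} (hs : 0 ≤ s) (ξ : Space N) (c : ℝ) (x : Space N) :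
    ∫ z, wave ξ c (mehler s (x, z)) ∂gaussMeasure N = waveEvolution ξ c s x := by
  have h := integral_cos_gaussMeasure (noise s • ξ) (inner ℝ (Real.exp (-s) • ξ) x + c)
  rw [norm_smul, mul_pow, Real.norm_eq_abs, sq_abs, noise_sq hs] at h
  rw [waveEvolution, wave]
  convert! h using 3 with z
  · simp only [wave, mehler, inner_add_right, inner_smul_right, inner_smul_left,
      RCLike.conj_to_real]
    congr 1
    ring
  · ring

lemma amplitude_le_one {N : ℕ} {s : ℝ} (hs : 0 ≤ s) (ξ : Space N) :
    Real.exp (-‖ξ‖ ^ 2 / 2 * (1 - Real.exp (-2 * s))) ≤ 1 := by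
  rw [Real.exp_le_one_iff]
  have h1 : 0 ≤ 1 - Real.exp (-2 * s) := by simpa using hs
  have h2 : 0 ≤ ‖ξ‖ ^ 2 / 2 := by positivity
  nlinarith

lemma abs_waveEvolution_le {N : ℕ} {s : ℝ} (hs : 0 ≤ s) (ξ : Space N) (c : ℝ) (x : Space N) :
    |waveEvolution ξ c s x| ≤ 1 := by
  rw [waveEvolution, abs_mul, Real.abs_exp]
  exact mul_le_one₀ (amplitude_le_one hs ξ) (abs_nonneg _) (abs_wave_le _ _ _)

/-- `𝓛` applied to the evolution of a plane wave. -/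
def ouWaveEvolution {N : ℕ} (ξ : Space N) (c s : ℝ) (x : Space N) : ℝ :=
  Real.exp (-‖ξ‖ ^ 2 / 2 * (1 - Real.exp (-2 * s))) * ouOperator (wave (Real.exp (-s) • ξ) c) x

lemma continuous_ouWaveEvolution {N : ℕ} (ξ : Space N) (c : ℝ) :
    Continuous (fun q : ℝ × Space N => ouWaveEvolution ξ c q.1 q.2) := by
  unfold ouWaveEvolution
  simp_rw [ouOperator_wave]
  unfold wave
  fun_prop

/-- The evolution of a plane wave solves the Ornstein-Uhlenbeck equation. -/
lemma hasDerivAt_waveEvolution {N : ℕ} (ξ : Space N) (c s : ℝ) (x : Space N) :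
    HasDerivAt (fun s => waveEvolution ξ c s x) (ouWaveEvolution ξ c s x) s := by
  have h1 : HasDerivAt (fun s : ℝ => Real.exp (-2 * s)) (Real.exp (-2 * s) * (-2 * 1)) s :=
    ((hasDerivAt_id s).const_mul (-2)).exp
  have h2 : HasDerivAt (fun s : ℝ => Real.exp (-s)) (Real.exp (-s) * (-1)) s :=
    (hasDerivAt_id s).neg.exp
  have h3 := ((h1.const_sub 1).const_mul (-‖ξ‖ ^ 2 / 2)).exp
  have h4 := ((h2.mul_const (inner ℝ ξ x)).add_const c).cos
  have h5 := h3.mul h4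
  have hfun : (fun s => waveEvolution ξ c s x) = (fun s =>
      Real.exp (-‖ξ‖ ^ 2 / 2 * (1 - Real.exp (-2 * s)))) *
      fun s => Real.cos (Real.exp (-s) * inner ℝ ξ x + c) := by
    ext s
    simp [waveEvolution, wave, inner_smul_left]
  rw [hfun]
  convert! h5 using 1
  have he : Real.exp (-2 * s) = Real.exp (-s) ^ 2 := by
    rw [← Real.exp_nat_mul]; push_cast; ring_nf
  rw [ouWaveEvolution, ouOperator_wave, wave, norm_smul, inner_smul_left, Real.norm_eq_abs,
    Real.abs_exp, mul_pow, he]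
  simp only [RCLike.conj_to_real]
  ring

lemma abs_ouWaveEvolution_le {N : ℕ} {s : ℝ} (hs : 0 ≤ s) (ξ : Space N) (c : ℝ) (x : Space N) :
    |ouWaveEvolution ξ c s x| ≤ (‖ξ‖ ^ 2 + ‖ξ‖) * (1 + ‖x‖) := by
  have he : Real.exp (-s) ≤ 1 := by simpa using hs
  have hξ : ‖Real.exp (-s) • ξ‖ ≤ ‖ξ‖ := by
    rw [norm_smul, Real.norm_eq_abs, Real.abs_exp]
    exact mul_le_of_le_one_left (norm_nonneg _) he
  rw [ouWaveEvolution, abs_mul, Real.abs_exp]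
  refine (mul_le_of_le_one_left (abs_nonneg _) (amplitude_le_one hs ξ)).trans ?_
  rw [ouOperator_wave]
  calc |-‖Real.exp (-s) • ξ‖ ^ 2 * wave (Real.exp (-s) • ξ) c x
        + inner ℝ (Real.exp (-s) • ξ) x * Real.sin (inner ℝ (Real.exp (-s) • ξ) x + c)|
      ≤ ‖Real.exp (-s) • ξ‖ ^ 2 * 1 + ‖Real.exp (-s) • ξ‖ * ‖x‖ * 1 := by
        refine (abs_add_le _ _).trans (add_le_add ?_ ?_)
        · rw [abs_mul, abs_neg, abs_of_nonneg (sq_nonneg _)]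
          gcongr
          exact abs_wave_le _ _ _
        · rw [abs_mul]
          gcongr
          · exact abs_real_inner_le_norm _ _
          · exact Real.abs_sin_le_one _
    _ ≤ ‖ξ‖ ^ 2 * 1 + ‖ξ‖ * ‖x‖ * 1 := by gcongr
    _ ≤ ‖ξ‖ ^ 2 * 1 + ‖ξ‖ * ‖x‖ * 1 + (‖ξ‖ ^ 2 * ‖x‖ + ‖ξ‖) :=
        le_add_of_nonneg_right (by positivity)
    _ = (‖ξ‖ ^ 2 + ‖ξ‖) * (1 + ‖x‖) := by ring

/-- The weak form of `G_t f - f = ∫₀ᵗ G_s h ds`, tested with a plane wave. -/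
lemma HasOU.integral_waveEvolution_sub {N : ℕ} {p : ℝ} (hp : 1 < p) {f h : Space N → ℝ}
    (H : HasOU p f h) (ξ : Space N) (c : ℝ) {t : ℝ} (ht : 0 < t) :
    ∫ x, f x * (waveEvolution ξ c t x - wave ξ c x) ∂gaussMeasure N
      = ∫ x, h x * (∫ s in 0..t, waveEvolution ξ c s x) ∂gaussMeasure N := by
  have hp1 : 1 ≤ ENNReal.ofReal p := by simpa using hp.le
  have hh := H.memLp_image.integrable hp1
  have hnonneg : ∀ᵐ q ∂(volume.restrict (uIoc 0 t)).prod (gaussMeasure N), 0 ≤ q.1 := by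
    refine Measure.quasiMeasurePreserving_fst.ae (p := fun s => 0 ≤ s) ?_
    filter_upwards [ae_restrict_mem measurableSet_uIoc] with s hs
    rw [uIoc_of_le ht.le] at hs
    exact hs.1.le
  have hfin : IsFiniteMeasure (volume.restrict (uIoc 0 t)) := by
    rw [uIoc_of_le ht.le]; infer_instance
  have hint1 : Integrable (Function.uncurry fun s x => f x * ouWaveEvolution ξ c s x)
      ((volume.restrict (uIoc 0 t)).prod (gaussMeasure N)) := by
    have hdom := ((integrable_mul_one_add_norm hp H.memLp).norm.const_mul
      (‖ξ‖ ^ 2 + ‖ξ‖)).comp_snd (volume.restrict (uIoc 0 t))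
    refine hdom.mono (H.memLp.1.comp_snd.mul
      (continuous_ouWaveEvolution ξ c).aestronglyMeasurable) ?_
    filter_upwards [hnonneg] with q hq
    have h1 := abs_ouWaveEvolution_le hq ξ c q.2
    simp only [Function.uncurry]
    rw [norm_mul, norm_mul, norm_norm, norm_mul,
      Real.norm_of_nonneg (by positivity : 0 ≤ 1 + ‖q.2‖),
      Real.norm_of_nonneg (by positivity : 0 ≤ ‖ξ‖ ^ 2 + ‖ξ‖), mul_left_comm]
    gcongr
    exact h1
  have hint2 : Integrable (Function.uncurry fun s x => h x * waveEvolution ξ c s x)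
      ((volume.restrict (uIoc 0 t)).prod (gaussMeasure N)) := by
    refine (hh.comp_snd (volume.restrict (uIoc 0 t))).mul_bdd (c := 1)
      (continuous_waveEvolution ξ c).aestronglyMeasurable ?_
    filter_upwards [hnonneg] with q hq using abs_waveEvolution_le hq ξ c q.2
  have hcont : ∀ x, Continuous fun s => ouWaveEvolution ξ c s x := fun x =>
    (continuous_ouWaveEvolution ξ c).comp (Continuous.prodMk_left x)
  calc ∫ x, f x * (waveEvolution ξ c t x - wave ξ c x) ∂gaussMeasure N
      = ∫ x, (∫ s in 0..t, f x * ouWaveEvolution ξ c s x) ∂gaussMeasure N := by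
        refine integral_congr_ae (ae_of_all _ fun x => ?_)
        simp only
        rw [intervalIntegral.integral_const_mul, intervalIntegral.integral_eq_sub_of_hasDerivAt
          (fun s _ => hasDerivAt_waveEvolution ξ c s x) ((hcont x).intervalIntegrable _ _),
          waveEvolution_zero]
    _ = ∫ s in 0..t, ∫ x, f x * ouWaveEvolution ξ c s x ∂gaussMeasure N :=
        (intervalIntegral_integral_swap hint1).symm
    _ = ∫ s in 0..t, ∫ x, h x * waveEvolution ξ c s x ∂gaussMeasure N := by
        congr 1
        ext1 s
        simp_rw [ouWaveEvolution, waveEvolution, mul_left_comm _ (Real.exp _)]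
        rw [integral_const_mul, integral_const_mul, H.integral_wave hp]
    _ = ∫ x, (∫ s in 0..t, h x * waveEvolution ξ c s x) ∂gaussMeasure N :=
        intervalIntegral_integral_swap hint2
    _ = _ := by simp_rw [intervalIntegral.integral_const_mul]

/-- Plane waves separate integrable functions, by uniqueness of characteristic functions. -/
lemma ae_eq_zero_of_integral_mul_wave {N : ℕ} {w : Space N → ℝ}
    (hw : Integrable w (gaussMeasure N))
    (h : ∀ ξ c, ∫ x, w x * wave ξ c x ∂gaussMeasure N = 0) : w =ᵐ[gaussMeasure N] 0 := by
  -- The sine is the plane wave with phase `-π / 2`.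
  have hchar : ∀ ξ : Space N,
      ∫ x, (w x : ℂ) * Complex.exp (inner ℝ x ξ * Complex.I) ∂gaussMeasure N = 0 := fun ξ => by
    have h1 : ∀ x, (w x : ℂ) * Complex.exp (inner ℝ x ξ * Complex.I)
        = ((w x * wave ξ 0 x : ℝ) : ℂ) + ((w x * wave ξ (-(Real.pi / 2)) x : ℝ) : ℂ) * Complex.I :=
      fun x => by
        rw [wave, wave, ← sub_eq_add_neg, Real.cos_sub_pi_div_two, add_zero, Complex.exp_mul_I,
          real_inner_comm]
        push_cast
        ring
    have hi : ∀ c, Integrable (fun x => ((w x * wave ξ c x : ℝ) : ℂ)) (gaussMeasure N) := fun c =>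
      (hw.mul_bdd (c := 1) (contDiff_wave ξ c).continuous.aestronglyMeasurable
        (ae_of_all _ (abs_wave_le ξ c))).ofReal
    simp_rw [h1]
    rw [integral_add (hi _) ((hi _).mul_const _), integral_mul_const, integral_complex_ofReal,
      integral_complex_ofReal, h, h]
    simp
  -- The positive and the negative part of `w` are densities of finite measures; the difference of
  -- their characteristic functions is the integral in `hchar`.
  have hfin1 := isFiniteMeasure_withDensity_ofReal hw.2
  have hfin2 : IsFiniteMeasure ((gaussMeasure N).withDensity fun x => ENNReal.ofReal (-w x)) :=
    isFiniteMeasure_withDensity_ofReal hw.neg.2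
  have hint : ∀ v : Space N → ℝ, Integrable v (gaussMeasure N) → ∀ ξ : Space N, Integrable
      (fun x => (ENNReal.ofReal (v x)).toReal • Complex.exp (inner ℝ x ξ * Complex.I))
      (gaussMeasure N) := fun v hv ξ => by
    have hpos : Integrable (fun x => (ENNReal.ofReal (v x)).toReal) (gaussMeasure N) :=
      hv.pos_part.congr (ae_of_all _ fun x => ENNReal.toReal_ofReal'.symm)
    refine hpos.smul_bdd 1 (by fun_prop) (ae_of_all _ fun x => ?_)
    rw [Complex.norm_exp_ofReal_mul_I]
  have hm1 : AEMeasurable (fun x => ENNReal.ofReal (w x)) (gaussMeasure N) :=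
    hw.1.aemeasurable.ennreal_ofReal
  have hm2 : AEMeasurable (fun x => ENNReal.ofReal (-w x)) (gaussMeasure N) :=
    hw.1.aemeasurable.neg.ennreal_ofReal
  have heq : (gaussMeasure N).withDensity (fun x => ENNReal.ofReal (w x))
      = (gaussMeasure N).withDensity (fun x => ENNReal.ofReal (-w x)) := by
    refine Measure.ext_of_charFun (funext fun ξ => ?_)
    rw [charFun_apply, charFun_apply,
      integral_withDensity_eq_integral_toReal_smul₀ hm1
        (ae_of_all _ fun _ => ENNReal.ofReal_lt_top),
      integral_withDensity_eq_integral_toReal_smul₀ hm2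
        (ae_of_all _ fun _ => ENNReal.ofReal_lt_top),
      ← sub_eq_zero, ← integral_sub (hint w hw ξ) (hint (fun x => -w x) hw.neg ξ), ← hchar ξ]
    congr 1
    ext1 x
    rw [Complex.real_smul, Complex.real_smul, ← sub_mul, ← Complex.ofReal_sub]
    congr 2
    rcases le_total 0 (w x) with hx | hx
    · rw [ENNReal.toReal_ofReal hx, ENNReal.ofReal_of_nonpos (by linarith)]; simp
    · rw [ENNReal.ofReal_of_nonpos hx, ENNReal.toReal_ofReal (by linarith)]; simp
  rw [withDensity_eq_iff hm1 hm2 hw.lintegral_lt_top.ne] at heq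
  filter_upwards [heq] with x hx
  rcases le_total 0 (w x) with h0 | h0
  · rw [ENNReal.ofReal_of_nonpos (by linarith : -w x ≤ 0), ENNReal.ofReal_eq_zero] at hx
    exact le_antisymm hx h0
  · rw [ENNReal.ofReal_of_nonpos h0, eq_comm, ENNReal.ofReal_eq_zero] at hx
    simp only [Pi.zero_apply]
    linarith

/-! ### Duhamel's formula -/

/-- The law of a pair of independent variables: a uniform time in `(0, 1]` and a standard Gaussian
vector. -/
def timeNoise (N : ℕ) : Measure (ℝ × Space N) := (volume.restrict (Ioc 0 1)).prod (gaussMeasure N)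

instance isProbabilityMeasure_unitInterval :
    IsProbabilityMeasure ((volume : Measure ℝ).restrict (Ioc 0 1)) := ⟨by simp⟩

instance isProbabilityMeasure_timeNoise (N : ℕ) : IsProbabilityMeasure (timeNoise N) := by
  unfold timeNoise; infer_instance

/-- The Mehler reflection at the time `t * r`, where `r` is the time coordinate. -/
def timeReflection {N : ℕ} (t : ℝ) (q : Space N × (ℝ × Space N)) : Space N × (ℝ × Space N) :=
  ((mehlerReflection (t * q.2.1) (q.1, q.2.2)).1,
    (q.2.1, (mehlerReflection (t * q.2.1) (q.1, q.2.2)).2))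

lemma measurable_timeReflection {N : ℕ} (t : ℝ) : Measurable (timeReflection (N := N) t) := by
  unfold timeReflection mehlerReflection mehler
  fun_prop

lemma measurePreserving_timeReflection {N : ℕ} {t : ℝ} (ht : 0 ≤ t) :
    MeasurePreserving (timeReflection (N := N) t) ((gaussMeasure N).prod (timeNoise N))
      ((gaussMeasure N).prod (timeNoise N)) := by
  refine ⟨measurable_timeReflection t, Measure.ext_of_lintegral _ fun F hF => ?_⟩
  -- For a fixed time coordinate, integrate over the pair of space coordinates.
  have key : ∀ G : Space N × (ℝ × Space N) → ℝ≥0∞, Measurable G →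
      ∫⁻ q, G q ∂(gaussMeasure N).prod (timeNoise N)
        = ∫⁻ r in Ioc (0 : ℝ) 1, ∫⁻ q, G (q.1, (r, q.2)) ∂(gaussMeasure N).prod (gaussMeasure N) :=
    fun G hG => by
      rw [lintegral_prod _ hG.aemeasurable]
      have h1 : ∀ x, ∫⁻ w, G (x, w) ∂timeNoise N
          = ∫⁻ r in Ioc (0 : ℝ) 1, ∫⁻ z, G (x, (r, z)) ∂gaussMeasure N := fun x =>
        lintegral_prod _ (hG.comp measurable_prodMk_left).aemeasurable
      simp_rw [h1]
      rw [lintegral_lintegral_swap]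
      · refine lintegral_congr fun r => ?_
        rw [lintegral_prod]
        exact (hG.comp (by fun_prop)).aemeasurable
      · exact (Measurable.lintegral_prod_right (f := fun (a : Space N × ℝ) (z : Space N) =>
          G (a.1, (a.2, z))) (hG.comp (by fun_prop))).aemeasurable
  rw [lintegral_map hF (measurable_timeReflection t),
    key (fun q => F (timeReflection t q)) (hF.comp (measurable_timeReflection t)), key F hF]
  refine setLIntegral_congr_fun measurableSet_Ioc fun r hr => ?_
  have hR := measurePreserving_mehlerReflection (N := N) (mul_nonneg ht hr.1.le)
  exact hR.lintegral_comp (f := fun q => F (q.1, (r, q.2))) (hF.comp (by fun_prop))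

lemma timeReflection_timeReflection {N : ℕ} {t : ℝ} (ht : 0 ≤ t) :
    ∀ᵐ q ∂(gaussMeasure N).prod (timeNoise N), (timeReflection t (timeReflection t q)).1 = q.1 := by
  have hr : ∀ᵐ w ∂timeNoise N, 0 ≤ w.1 := by
    refine Measure.quasiMeasurePreserving_fst.ae (p := fun s => 0 ≤ s) ?_
    filter_upwards [ae_restrict_mem measurableSet_Ioc] with s hs using hs.1.le
  filter_upwards [Measure.quasiMeasurePreserving_snd.ae hr] with q hq
  exact mehler_mehlerReflection (mul_nonneg ht hq) (q.1, q.2.2)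

/-- The time average `(1 / t) ∫₀ᵗ G_s h ds`, as a mean over a uniform time in `(0, 1]`, scaled by
`t`, and a Gaussian vector. -/
def ouAverage {N : ℕ} (t : ℝ) (h : Space N → ℝ) (x : Space N) : ℝ :=
  ∫ w, h (timeReflection t (x, w)).1 ∂timeNoise N

/-- On a plane wave, `ouAverage` is indeed the time average of the evolution: substitute `s = t r`
for the uniform time `r`. -/
lemma ouAverage_wave {N : ℕ} {t : ℝ} (ht : 0 < t) (ξ : Space N) (c : ℝ) (x : Space N) :
    t * ouAverage t (wave ξ c) x = ∫ s in 0..t, waveEvolution ξ c s x := by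
  have hcont : Continuous (wave ξ c) := (contDiff_wave ξ c).continuous
  have hint : Integrable (fun w : ℝ × Space N => wave ξ c (timeReflection t (x, w)).1)
      ((volume.restrict (Ioc 0 1)).prod (gaussMeasure N)) := by
    refine Integrable.of_bound (C := 1) ?_ (ae_of_all _ fun w => abs_wave_le _ _ _)
    exact (hcont.measurable.comp (measurable_fst.comp ((measurable_timeReflection t).comp
      measurable_prodMk_left))).aestronglyMeasurable
  have h1 : ouAverage t (wave ξ c) x = ∫ r in (0 : ℝ)..1, waveEvolution ξ c (t * r) x := by
    rw [ouAverage, timeNoise, integral_prod _ hint, intervalIntegral.integral_of_le zero_le_one]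
    refine setIntegral_congr_fun measurableSet_Ioc fun r hr => ?_
    exact integral_wave_mehler (mul_nonneg ht.le hr.1.le) ξ c x
  rw [h1, intervalIntegral.integral_comp_mul_left (fun s => waveEvolution ξ c s x) ht.ne',
    smul_eq_mul, mul_inv_cancel_left₀ ht.ne', mul_zero, mul_one]

lemma integrable_comp_timeReflection {N : ℕ} {t : ℝ} (ht : 0 ≤ t) {h : Space N → ℝ}
    (hh : Integrable h (gaussMeasure N)) :
    Integrable (fun q => h (timeReflection t q).1) ((gaussMeasure N).prod (timeNoise N)) :=
  (measurePreserving_fst.comp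
    (measurePreserving_timeReflection ht)).integrable_comp_of_integrable hh

lemma integrable_ouSemigroup {N : ℕ} {t : ℝ} (ht : 0 < t) {f : Space N → ℝ}
    (hf : Integrable f (gaussMeasure N)) : Integrable (ouSemigroup t f) (gaussMeasure N) := by
  have h := ((measurePreserving_fst.comp
    (measurePreserving_mehlerReflection ht.le)).integrable_comp_of_integrable hf).integral_prod_left
  exact h.congr (ae_of_all _ fun x => (ouSemigroup_eq_integral_mehler ht f x).symm)

/-- Duhamel's formula `G_t f - f = ∫₀ᵗ G_s h ds` for `h = 𝓛 f`. Both sides have the same integral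
against every plane wave, since `G_s` is symmetric. -/
lemma HasOU.ouSemigroup_sub_ae_eq {N : ℕ} {p : ℝ} (hp : 1 < p) {f h : Space N → ℝ}
    (H : HasOU p f h) {t : ℝ} (ht : 0 < t) :
    (fun x => ouSemigroup t f x - f x) =ᵐ[gaussMeasure N] fun x => t * ouAverage t h x := by
  have hp1 : 1 ≤ ENNReal.ofReal p := by simpa using hp.le
  have hf := H.memLp.integrable hp1
  have hh := H.memLp_image.integrable hp1
  have hG := integrable_ouSemigroup ht hf
  have hA : Integrable (ouAverage t h) (gaussMeasure N) :=
    (integrable_comp_timeReflection ht.le hh).integral_prod_left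
  have hwave : ∀ ξ c, AEStronglyMeasurable (wave ξ c) (gaussMeasure N) := fun ξ c =>
    (contDiff_wave ξ c).continuous.aestronglyMeasurable
  have hmul : ∀ {v : Space N → ℝ}, Integrable v (gaussMeasure N) → ∀ ξ c,
      Integrable (fun x => v x * wave ξ c x) (gaussMeasure N) := fun hv ξ c =>
    hv.mul_bdd (c := 1) (hwave ξ c) (ae_of_all _ (abs_wave_le ξ c))
  have hzero := ae_eq_zero_of_integral_mul_wave ((hG.sub hf).sub (hA.const_mul t)) fun ξ c => by
    have h1 : ∫ x, ouSemigroup t f x * wave ξ c x ∂gaussMeasure N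
        = ∫ x, f x * waveEvolution ξ c t x ∂gaussMeasure N := by
      simp_rw [ouSemigroup_eq_integral_mehler ht, ← integral_wave_mehler ht.le ξ c]
      exact integral_average_mul (measurePreserving_mehlerReflection ht.le)
        (ae_of_all _ (mehler_mehlerReflection ht.le)) hf (contDiff_wave ξ c).continuous.measurable
        (abs_wave_le ξ c)
    have h2 : ∫ x, ouAverage t h x * wave ξ c x ∂gaussMeasure N
        = ∫ x, h x * ouAverage t (wave ξ c) x ∂gaussMeasure N :=
      integral_average_mul (measurePreserving_timeReflection ht.le)
        (timeReflection_timeReflection ht.le) hh (contDiff_wave ξ c).continuous.measurable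
        (abs_wave_le ξ c)
    have h3 := H.integral_waveEvolution_sub hp ξ c ht
    have hev : Integrable (fun x => f x * waveEvolution ξ c t x) (gaussMeasure N) :=
      hf.mul_bdd (c := 1)
        ((continuous_waveEvolution ξ c).comp (Continuous.prodMk_right t)).aestronglyMeasurable
        (ae_of_all _ (abs_waveEvolution_le ht.le ξ c))
    simp_rw [mul_sub] at h3
    rw [integral_sub hev (hmul hf ξ c)] at h3
    simp_rw [← ouAverage_wave ht, mul_left_comm _ t] at h3
    rw [integral_const_mul, ← h2, ← h1] at h3
    simp only [Pi.sub_apply, sub_mul, mul_assoc]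
    rw [integral_sub, integral_sub (hmul hG ξ c) (hmul hf ξ c), integral_const_mul, h3, sub_self]
    · exact (hmul hG ξ c).sub (hmul hf ξ c)
    · exact (hmul hA ξ c).const_mul t
  filter_upwards [hzero] with x hx
  simp only [Pi.sub_apply, Pi.zero_apply] at hx
  linarith

/-! ### Strong continuity -/

lemma aestronglyMeasurable_comp_timeReflection {N : ℕ} {t : ℝ} (ht : 0 ≤ t) {h : Space N → ℝ}
    (hh : AEStronglyMeasurable h (gaussMeasure N)) :
    AEStronglyMeasurable (fun q => h (timeReflection t q).1)
      ((gaussMeasure N).prod (timeNoise N)) :=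
  hh.comp_measurePreserving (measurePreserving_fst.comp (measurePreserving_timeReflection ht))

lemma eLpNorm_comp_timeReflection {N : ℕ} {t : ℝ} (ht : 0 ≤ t) {h : Space N → ℝ}
    (hh : AEStronglyMeasurable h (gaussMeasure N)) (P : ℝ≥0∞) :
    eLpNorm (fun q => h (timeReflection t q).1) P ((gaussMeasure N).prod (timeNoise N))
      = eLpNorm h P (gaussMeasure N) :=
  eLpNorm_comp_measurePreserving hh
    (measurePreserving_fst.comp (measurePreserving_timeReflection ht))

lemma eLpNorm_ouAverage_le {N : ℕ} {t : ℝ} (ht : 0 ≤ t) {P : ℝ≥0∞} (hP : 1 ≤ P) (hP' : P ≠ ⊤)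
    {h : Space N → ℝ} (hh : AEStronglyMeasurable h (gaussMeasure N)) :
    eLpNorm (ouAverage t h) P (gaussMeasure N) ≤ eLpNorm h P (gaussMeasure N) :=
  (eLpNorm_integral_prod_le hP hP' (aestronglyMeasurable_comp_timeReflection ht hh)).trans_eq
    (eLpNorm_comp_timeReflection ht hh P)

lemma continuous_timeReflection_fst {N : ℕ} (q : Space N × (ℝ × Space N)) :
    Continuous fun t => (timeReflection t q).1 := by
  unfold timeReflection mehlerReflection mehler
  fun_prop

lemma timeReflection_zero_fst {N : ℕ} (q : Space N × (ℝ × Space N)) :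
    (timeReflection 0 q).1 = q.1 := by
  simp [timeReflection, mehlerReflection, mehler, noise]

open scoped BoundedContinuousFunction in
lemma tendsto_eLpNorm_boundedContinuous_timeReflection {N : ℕ} {P : ℝ≥0∞} (hP : P ≠ 0) (hP' : P ≠ ⊤)
    (g : Space N →ᵇ ℝ) :
    Tendsto (fun t => eLpNorm (fun q => g (timeReflection t q).1 - g q.1) P
      ((gaussMeasure N).prod (timeNoise N))) (𝓝[>] 0) (𝓝 0) := by
  have hPr : 0 < P.toReal := ENNReal.toReal_pos hP hP'
  simp_rw [eLpNorm_eq_lintegral_rpow_enorm_toReal hP hP']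
  have h : Tendsto (fun t => ∫⁻ q, ‖g (timeReflection t q).1 - g q.1‖ₑ ^ P.toReal
      ∂(gaussMeasure N).prod (timeNoise N)) (𝓝[>] 0)
      (𝓝 (∫⁻ _, 0 ∂(gaussMeasure N).prod (timeNoise N))) := by
    refine tendsto_lintegral_filter_of_dominated_convergence
      (fun _ => ENNReal.ofReal (2 * ‖g‖) ^ P.toReal) (Eventually.of_forall fun t => ?_)
      (Eventually.of_forall fun t => ae_of_all _ fun q => ?_) ?_ (ae_of_all _ fun q => ?_)
    · have h1 : Measurable fun q : Space N × (ℝ × Space N) => g (timeReflection t q).1 :=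
        g.continuous.measurable.comp (measurable_fst.comp (measurable_timeReflection t))
      have h2 : Measurable fun q : Space N × (ℝ × Space N) => g q.1 :=
        g.continuous.measurable.comp measurable_fst
      exact (h1.sub h2).enorm.pow_const _
    · gcongr
      rw [← ofReal_norm, ← dist_eq_norm]
      exact ENNReal.ofReal_le_ofReal (g.dist_le_two_norm _ _)
    · rw [lintegral_const, measure_univ, mul_one]
      exact ENNReal.rpow_ne_top_of_nonneg hPr.le ENNReal.ofReal_ne_top
    · have hc : Continuous fun t => ‖g (timeReflection t q).1 - g q.1‖ₑ ^ P.toReal :=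
        (ENNReal.continuous_rpow_const).comp
          ((g.continuous.comp (continuous_timeReflection_fst q)).sub continuous_const).enorm
      have h0 := (hc.tendsto 0).mono_left (nhdsWithin_le_nhds (s := Ioi 0))
      simpa [timeReflection_zero_fst, hPr] using h0
  rw [lintegral_zero] at h
  have h2 := (ENNReal.continuous_rpow_const (y := 1 / P.toReal)).tendsto 0 |>.comp h
  rw [ENNReal.zero_rpow_of_pos (by positivity)] at h2
  exact h2

/-- Continuity in `L^p` along the Mehler flow: approximate `h` by a bounded continuous function and
use that the flow preserves the Gauss measure. -/
lemma tendsto_eLpNorm_timeReflection {N : ℕ} {P : ℝ≥0∞} (hP : 1 ≤ P) (hP' : P ≠ ⊤)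
    {h : Space N → ℝ} (hh : MemLp h P (gaussMeasure N)) :
    Tendsto (fun t => eLpNorm (fun q => h (timeReflection t q).1 - h q.1) P
      ((gaussMeasure N).prod (timeNoise N))) (𝓝[>] 0) (𝓝 0) := by
  rw [ENNReal.tendsto_nhds_zero]
  intro δ hδ
  obtain ⟨g', hg, -⟩ := hh.exists_boundedContinuous_eLpNorm_sub_le hP'
    (ε := δ / 3) (ENNReal.div_pos hδ.ne' (by norm_num)).ne'
  have hlim := tendsto_eLpNorm_boundedContinuous_timeReflection (N := N)
    (zero_lt_one.trans_le hP).ne' hP' g'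
  have hgm : AEStronglyMeasurable g' (gaussMeasure N) := g'.continuous.aestronglyMeasurable
  generalize (g' : Space N → ℝ) = g at hg hlim hgm
  rw [ENNReal.tendsto_nhds_zero] at hlim
  filter_upwards [hlim (δ / 3) (ENNReal.div_pos hδ.ne' (by norm_num)), self_mem_nhdsWithin]
    with t ht ht0
  have ht0' : 0 ≤ t := le_of_lt ht0
  have hd : AEStronglyMeasurable (h - g) (gaussMeasure N) := hh.1.sub hgm
  have h1 : AEStronglyMeasurable (fun q => (h - g) (timeReflection t q).1)
      ((gaussMeasure N).prod (timeNoise N)) := aestronglyMeasurable_comp_timeReflection ht0' hd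
  have h2 : AEStronglyMeasurable (fun q => g (timeReflection t q).1 - g q.1)
      ((gaussMeasure N).prod (timeNoise N)) :=
    (aestronglyMeasurable_comp_timeReflection ht0' hgm).sub hgm.comp_fst
  have h3 : AEStronglyMeasurable (fun q : Space N × (ℝ × Space N) => (h - g) q.1)
      ((gaussMeasure N).prod (timeNoise N)) := hd.comp_fst
  have hfun : (fun q => h (timeReflection t q).1 - h q.1)
      = (fun q => (h - g) (timeReflection t q).1) + (fun q => g (timeReflection t q).1 - g q.1)
        - fun q => (h - g) q.1 := by
    ext q
    simp only [Pi.sub_apply, Pi.add_apply]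
    ring
  calc eLpNorm (fun q => h (timeReflection t q).1 - h q.1) P _
      ≤ δ / 3 + δ / 3 + δ / 3 := by
        rw [hfun]
        refine (eLpNorm_sub_le (h1.add h2) h3 hP).trans
          (add_le_add ((eLpNorm_add_le h1 h2 hP).trans (add_le_add ?_ ht)) ?_)
        · rw [eLpNorm_comp_timeReflection ht0' hd]
          exact hg
        · exact (eLpNorm_comp_measurePreserving hd measurePreserving_fst).trans_le hg
    _ = δ := ENNReal.add_thirds δ

lemma tendsto_eLpNorm_ouAverage {N : ℕ} {P : ℝ≥0∞} (hP : 1 ≤ P) (hP' : P ≠ ⊤)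
    {h : Space N → ℝ} (hh : MemLp h P (gaussMeasure N)) :
    Tendsto (fun t => eLpNorm (ouAverage t h) P (gaussMeasure N)) (𝓝[>] 0)
      (𝓝 (eLpNorm h P (gaussMeasure N))) := by
  have hlow := ENNReal.Tendsto.sub (tendsto_const_nhds (x := eLpNorm h P (gaussMeasure N)))
    (tendsto_eLpNorm_timeReflection hP hP' hh) (Or.inl hh.2.ne)
  rw [tsub_zero] at hlow
  -- The upper bound is contractivity; the lower one is the triangle inequality, with the error
  -- `ouAverage t h - h` controlled by Jensen's inequality.
  refine tendsto_of_tendsto_of_tendsto_of_le_of_le' hlow tendsto_const_nhds ?_ ?_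
  · filter_upwards [self_mem_nhdsWithin] with t ht
    have ht0 : 0 ≤ t := le_of_lt ht
    have hi := integrable_comp_timeReflection ht0 (hh.integrable hP)
    have hA : AEStronglyMeasurable (ouAverage t h) (gaussMeasure N) := hi.integral_prod_left.1
    have hdiff : eLpNorm (ouAverage t h - h) P (gaussMeasure N)
        ≤ eLpNorm (fun q => h (timeReflection t q).1 - h q.1) P
          ((gaussMeasure N).prod (timeNoise N)) := by
      refine le_of_eq_of_le (eLpNorm_congr_ae ?_) (eLpNorm_integral_prod_le hP hP'
        ((aestronglyMeasurable_comp_timeReflection ht0 hh.1).sub hh.1.comp_fst))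
      filter_upwards [hi.prod_right_ae] with x hx
      rw [integral_sub hx (integrable_const _)]
      simp [ouAverage]
    rw [tsub_le_iff_right]
    calc eLpNorm h P (gaussMeasure N)
        = eLpNorm (ouAverage t h - (ouAverage t h - h)) P (gaussMeasure N) := by
          rw [sub_sub_cancel]
      _ ≤ _ := (eLpNorm_sub_le hA (hA.sub hh.1) hP).trans (add_le_add le_rfl hdiff)
  · filter_upwards [self_mem_nhdsWithin] with t ht
    exact eLpNorm_ouAverage_le (le_of_lt ht) hP hP' hh.1

/-! ### The limit of the Besov functionals -/

lemma aemeasurable_ouSemigroup {N : ℕ} {f : Space N → ℝ} {ν : Measure ℝ} [SFinite ν]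
    (hf : AEStronglyMeasurable f (gaussMeasure N)) :
    AEMeasurable (fun q : Space N × ℝ => ouSemigroup q.2 f q.1) ((gaussMeasure N).prod ν) := by
  have hK : Measurable fun a : (Space N × ℝ) × Space N =>
      Real.exp (-(Real.exp (-2 * a.1.2) * (‖a.1.1‖ ^ 2 + ‖a.2‖ ^ 2)
        - 2 * Real.exp (-a.1.2) * inner ℝ a.1.1 a.2) / (2 * (1 - Real.exp (-2 * a.1.2)))) := by
    fun_prop
  have hint := (hK.aestronglyMeasurable (μ := ((gaussMeasure N).prod ν).prod (gaussMeasure N))).mul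
    hf.comp_snd
  have hpre : Measurable fun q : Space N × ℝ => (1 - Real.exp (-2 * q.2)) ^ (-(N : ℝ) / 2) := by
    fun_prop
  exact hpre.aemeasurable.mul hint.integral_prod_right'.aemeasurable

/-- By Tonelli and Duhamel's formula, the Besov integral is an average of the norms of
`(G_t f - f) / t`. -/
lemma besovIntegral_eq {N : ℕ} {p : ℝ} (hp : 1 < p) {f h : Space N → ℝ} (H : HasOU p f h)
    {ρ : ℝ → ℝ} (hρ : AEMeasurable ρ (volume.restrict (Ioo 0 1))) :
    besovIntegral p ρ f = ∫⁻ t in Ioo (0 : ℝ) 1, ENNReal.ofReal (ρ t) *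
      eLpNorm (ouAverage t h) (ENNReal.ofReal p) (gaussMeasure N) ^ p := by
  have hp0 : 0 < p := by linarith
  have hmeas : AEMeasurable (Function.uncurry fun (x : Space N) (t : ℝ) =>
      ENNReal.ofReal (|f x - ouSemigroup t f x| ^ p / t ^ p * ρ t))
      ((gaussMeasure N).prod (volume.restrict (Ioo 0 1))) := by
    have h1 : AEMeasurable (fun q : Space N × ℝ => f q.1 - ouSemigroup q.2 f q.1)
        ((gaussMeasure N).prod (volume.restrict (Ioo 0 1))) :=
      H.memLp.1.comp_fst.aemeasurable.sub (aemeasurable_ouSemigroup H.memLp.1)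
    have h2 : AEMeasurable (fun q : Space N × ℝ => |f q.1 - ouSemigroup q.2 f q.1| ^ p)
        ((gaussMeasure N).prod (volume.restrict (Ioo 0 1))) :=
      (continuous_abs.measurable.comp_aemeasurable h1).pow_const p
    have h3 : Measurable fun q : Space N × ℝ => q.2 ^ p := by fun_prop
    have h4 : AEMeasurable (fun q : Space N × ℝ => ρ q.2)
        ((gaussMeasure N).prod (volume.restrict (Ioo 0 1))) := hρ.comp_snd
    exact ((h2.div h3.aemeasurable).mul h4).ennreal_ofReal
  rw [besovIntegral, lintegral_lintegral_swap hmeas]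
  refine setLIntegral_congr_fun measurableSet_Ioo fun t ht => ?_
  have hP0 : ENNReal.ofReal p ≠ 0 := by simpa using hp0
  rw [eLpNorm_eq_lintegral_rpow_enorm_toReal hP0 ENNReal.ofReal_ne_top,
    ENNReal.toReal_ofReal hp0.le,
    ← ENNReal.rpow_mul, one_div, inv_mul_cancel₀ hp0.ne', ENNReal.rpow_one,
    ← lintegral_const_mul' _ _ ENNReal.ofReal_ne_top]
  refine lintegral_congr_ae ?_
  filter_upwards [H.ouSemigroup_sub_ae_eq hp ht.1] with x hx
  have hdiv : |f x - ouSemigroup t f x| ^ p / t ^ p = |ouAverage t h x| ^ p := by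
    rw [abs_sub_comm, hx, abs_mul, abs_of_pos ht.1, Real.mul_rpow ht.1.le (abs_nonneg _),
      mul_div_cancel_left₀ _ (Real.rpow_pos_of_pos ht.1 p).ne']
  rw [hdiv, ENNReal.ofReal_mul (by positivity), mul_comm, ← ENNReal.ofReal_rpow_of_nonneg
    (abs_nonneg _) hp0.le, Real.enorm_eq_ofReal_abs]

lemma tendsto_besovIntegral {N : ℕ} {p : ℝ} (hp : 1 < p) {f h : Space N → ℝ} (H : HasOU p f h)
    {ρ : ℝ → ℝ → ℝ} (hρ : IsConcentrating ρ) :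
    Tendsto (fun ε => besovIntegral p (ρ ε) f) (𝓝[>] 0)
      (𝓝 (eLpNorm h (ENNReal.ofReal p) (gaussMeasure N) ^ p)) := by
  have hp0 : 0 < p := by linarith
  have hP : 1 ≤ ENNReal.ofReal p := by simpa using hp.le
  have h1 := ((ENNReal.continuous_rpow_const (y := p)).tendsto _).comp
    (tendsto_eLpNorm_ouAverage hP ENNReal.ofReal_ne_top H.memLp_image)
  refine (hρ.tendsto_lintegral h1 (M := eLpNorm h (ENNReal.ofReal p) (gaussMeasure N) ^ p)
    (ENNReal.rpow_ne_top_of_nonneg hp0.le H.memLp_image.2.ne) fun t ht => ?_).congr' ?_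
  · exact ENNReal.rpow_le_rpow
      (eLpNorm_ouAverage_le ht.1.le hP ENNReal.ofReal_ne_top H.memLp_image.1) hp0.le
  · filter_upwards [self_mem_nhdsWithin] with ε hε
    exact (besovIntegral_eq hp H (hρ.aemeasurable ε hε)).symm

end GaussSobolev

end

theorem mainTheorem9 (N : ℕ) (p : ℝ) (hp : 1 < p) (ρ : ℝ → ℝ → ℝ)
    (hρ_nonneg : ∀ ε > 0, ∀ t, 0 ≤ ρ ε t)
    (hρ_supp : ∀ ε > 0, Function.support (ρ ε) ⊆ Set.Ioo 0 1)
    (hρ_norm : ∀ ε > 0, ∫ t in Set.Ioi 0, ρ ε t = 1)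
    (hρ_conc : ∀ a ∈ Set.Ioo (0 : ℝ) 1,
      Tendsto (fun ε => ∫ t in Set.Ioo 0 a, ρ ε t) (𝓝[>] 0) (𝓝 1)) :
    (∀ f : GaussSobolev.Space N → ℝ,
      MemLp f (ENNReal.ofReal p) (GaussSobolev.gaussMeasure N) →
      Tendsto (fun ε => GaussSobolev.rearrangementIntegral p (ρ ε) f) (𝓝[>] 0)
        (𝓝 (GaussSobolev.zygmundNorm p (fun x => f x - GaussSobolev.mean f) ^ p))) ∧
    (∀ f h : GaussSobolev.Space N → ℝ, GaussSobolev.HasOU p f h →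
      Tendsto (fun ε => GaussSobolev.besovIntegral p (ρ ε) f) (𝓝[>] 0)
        (𝓝 (eLpNorm h (ENNReal.ofReal p) (GaussSobolev.gaussMeasure N) ^ p))) ∧
    (∀ f h : GaussSobolev.Space N → ℝ, GaussSobolev.HasOU p f h → ∀ C : ℝ≥0,
      (∀ ε > 0, GaussSobolev.rearrangementIntegral p (ρ ε) f
        ≤ C * GaussSobolev.besovIntegral p (ρ ε) f) →
      GaussSobolev.zygmundNorm p (fun x => f x - GaussSobolev.mean f)
        ≤ (C : ℝ≥0∞) ^ (1 / p) * eLpNorm h (ENNReal.ofReal p) (GaussSobolev.gaussMeasure N)) := by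
  have hp0 : 0 < p := by linarith
  have hρ := GaussSobolev.isConcentrating_of_integral hρ_nonneg hρ_supp hρ_norm hρ_conc
  have hi : ∀ f : GaussSobolev.Space N → ℝ,
      Tendsto (fun ε => GaussSobolev.rearrangementIntegral p (ρ ε) f) (𝓝[>] 0)
        (𝓝 (GaussSobolev.zygmundNorm p (fun x => f x - GaussSobolev.mean f) ^ p)) := fun f => by
    rw [GaussSobolev.zygmundNorm_rpow hp0]
    exact GaussSobolev.tendsto_lintegral_upsilon hp0.le hρ _
  refine ⟨fun f _ => hi f, fun f h H => GaussSobolev.tendsto_besovIntegral hp H hρ,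
    fun f h H C hC => ?_⟩
  have hlim := ENNReal.Tendsto.const_mul (GaussSobolev.tendsto_besovIntegral hp H hρ)
    (Or.inr (ENNReal.coe_ne_top (r := C)))
  have hle := le_of_tendsto_of_tendsto (hi f) hlim (by
    filter_upwards [self_mem_nhdsWithin] with ε hε using hC ε hε)
  have h := ENNReal.rpow_le_rpow hle (z := 1 / p) (by positivity)
  rwa [ENNReal.mul_rpow_of_nonneg _ _ (by positivity), ← ENNReal.rpow_mul, ← ENNReal.rpow_mul,
    mul_one_div_cancel hp0.ne', ENNReal.rpow_one, ENNReal.rpow_one] at h
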